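/- Let $\eta(\tau)=e^{2\pi i\tau/24}\prod_{n\ge 1}(1-e^{2\pi i n\tau})$ be the Dedekind eta function on the upper half plane $\mathbb H$, and write $\prod_i a_i^{d_i}$ for the $\eta$-quotient $\prod_i\eta(a_i\tau)^{d_i}$ ($a_i$ positive integers, $d_i\in\mathbb Z$; every number written below as the base of a power in the formulas for $y$ and $z$ has this meaning). Then the following identities hold for every $\tau\in\mathbb H$; in particular all denominators that occur in them (also $y+4$ and $y+8$ in (3), and $y+4$ in (7)) have no zeros on $\mathbb H$. (1) $z+16z^{-1}=y$ for $y=\frac{2^{24}}{1^{12}4^{12}}$, $z=\frac{1^4}{4^4}$. (2) $z+9+27z^{-1}=y$ for $y=\frac{3^{12}}{1^69^6}$, $z=\frac{1^3}{9^3}$. (3) For $y=\frac{1^44^2}{2^28^4}$: $z=\frac{y^4}{(y+4)(y+8)^2}$ with $z=\frac{1^{24}}{2^{24}}$, and $z=\frac{y(y+8)}{y+4}$ with $z=\frac{2^{12}}{4^{12}}$. (4) For $y=\frac{1^63^6}{2^66^6}$: $z+729z^{-1}+54=(y+16)^3y^{-2}$ with $z=\frac{1^{12}}{3^{12}}$,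 and $z+729z^{-1}+54=(y+4)^3y^{-1}$ with $z=\frac{2^{12}}{6^{12}}$. (5) For $y=\frac{1^22^2}{3^26^2}$: $z+64z^{-1}=(y^2+27)^2y^{-3}$ with $z=\frac{1^{12}}{2^{12}}$, and $z+64z^{-1}=(y^2+3)^2y^{-1}$ with $z=\frac{3^{12}}{6^{12}}$. (6) For $y=\frac{1^45^4}{2^410^4}$: $z+125z^{-1}+22=(y+4)(1+8y^{-1})^2$ with $z=\frac{1^6}{5^6}$, and $z+125z^{-1}+22=(y+2)^2(1+4y^{-1})$ with $z=\frac{2^6}{10^6}$. (7) For $y=\frac{1^23^2}{4^212^2}$: $z+729z^{-1}+54=\frac{(y+8)^6}{y^4(y+4)}$ with $z=\frac{1^{12}}{3^{12}}$; $z-27z^{-1}=\frac{(y+2)(y-4)(y+8)}{y(y+4)}$ with $z=\frac{2^6}{6^6}$; and $z+729z^{-1}+54=\frac{(y+2)^6}{y(y+4)}$ with $z=\frac{4^{12}}{12^{12}}$. (8) For $y=\frac{1^37^3}{2^314^3}$: $z+49z^{-1}+13=(y+4)^3y^{-2}$ with $z=\frac{1^4}{7^4}$, and $z+49z^{-1}+13=(y+2)^3y^{-1}$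 with $z=\frac{2^4}{14^4}$. (9) For $y=\frac{1^25^2}{3^215^2}$: $z+125z^{-1}+22=(y+9+27y^{-1})^2y^{-1}$ with $z=\frac{1^6}{5^6}$, and $z+125z^{-1}+22=(y+3+3y^{-1})^2y$ with $z=\frac{3^6}{15^6}$. -/

import Mathlib

open UpperHalfPlane

/-- The `η`-quotient `∏ᵢ η(aᵢ τ) ^ dᵢ`, given by the list of pairs `(aᵢ, dᵢ)` of positive integers `aᵢ`
and integer exponents `dᵢ`. Here `η` is the Dedekind eta function
`η(τ) = q ^ (1/24) * ∏ (1 - q ^ n)` with `q ^ (1/24) = exp (2 π i τ / 24)`. -/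
noncomputable def etaQuotient (l : List (ℕ × ℤ)) (τ : ℍ) : ℂ :=
  (l.map fun p => ModularForm.eta ((p.1 : ℂ) * (τ : ℂ)) ^ p.2).prod

/-!
An eta quotient of weight `0` with even exponents is, up to an explicit character, invariant under
`Γ₀(N)`, since `η ^ 2` has weight `1` and its multiplier factors through the abelianization
`ZMod 12` of `SL(2, ℤ)`. Its order at every cusp is given by Ligozat's formula. Hence a linear
combination of eta quotients, multiplied by one more eta quotient that moves all poles to infinity,
is a modular function for `Γ₀(N)` holomorphic at every cusp except infinity; once finitely many
coefficients of its `q`-expansion vanish it is a modular form of weight `0` that vanishes at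
infinity, hence `0`. The identities of level 9 and 14 involve odd exponents and are not covered;
written as `R = S` for suitable `R` and `S`, their squares `R ^ 2 = S ^ 2` are, and the leading
coefficient of `R + S` rules out `R = -S`.
-/

namespace EtaQuotient

open ModularForm MatrixGroups Filter Asymptotics Topology
open scoped Manifold

/-! ### The multiplier system of `η ^ 2` -/

/-- The primitive 24th root of unity `exp (2 π i / 24)`, the values of the multiplier system of
`η` being its powers. -/
noncomputable def zeta : ℂ := Complex.exp (2 * Real.pi * Complex.I / 24)

lemma zeta_ne_zero : zeta ≠ 0 := Complex.exp_ne_zero _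

lemma zeta_zpow_eq_one {n : ℤ} (hn : 24 ∣ n) : zeta ^ n = 1 := by
  obtain ⟨k, rfl⟩ := hn
  rw [zeta, ← Complex.exp_int_mul, Complex.exp_eq_one_iff]
  exact ⟨k, by push_cast; ring⟩

lemma zeta_zpow_congr {m n : ℤ} (h : 24 ∣ m - n) : zeta ^ m = zeta ^ n := by
  rw [← sub_add_cancel m n, zpow_add₀ zeta_ne_zero, zeta_zpow_eq_one h, one_mul]

lemma zeta_zpow_neg_six : zeta ^ (-6 : ℤ) = -Complex.I := by
  rw [zeta, ← Complex.exp_int_mul, ← Complex.exp_neg_pi_div_two_mul_I]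
  congr 1
  push_cast
  ring

/-- Modulo 12 this is the isomorphism from the abelianization of `SL(2, ℤ)` to `ZMod 12`, evaluated
at the matrix with rows `(a, b)` and `(c, d)`. Among the many representatives modulo 12 this one is
affine in `b` and in `c`, so that sums over the conjugates `(a, δ * b; c / δ, d)` are easy. -/
def psi {R : Type*} [CommRing R] (a b c d : R) : R :=
  b * d + ((a + 3) * (1 - d ^ 2) - d) * c + 3 * (d - 1) * (d - 2)

lemma cast_psi {R : Type*} [CommRing R] (a b c d : ℤ) :
    ((psi a b c d : ℤ) : R) = psi (a : R) b c d := by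
  simp [psi]

lemma twelve_dvd_of_zmod {n : ℤ} (h3 : (n : ZMod 3) = 0) (h4 : (n : ZMod 4) = 0) : 12 ∣ n := by
  rw [ZMod.intCast_zmod_eq_zero_iff_dvd] at h3 h4
  push_cast at h3 h4
  lia

lemma psi_S_mul {a b c d : ℤ} (h : a * d - b * c = 1) :
    12 ∣ psi (-c) (-d) a b - (psi a b c d - 3) := by
  have h3 : ∀ a b c d : ZMod 3, a * d - b * c = 1 →
      psi (-c) (-d) a b - (psi a b c d - 3) = 0 := by unfold psi; decide +kernel
  have h4 : ∀ a b c d : ZMod 4, a * d - b * c = 1 →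
      psi (-c) (-d) a b - (psi a b c d - 3) = 0 := by unfold psi; decide +kernel
  apply twelve_dvd_of_zmod
  · simpa [cast_psi] using h3 a b c d (by exact_mod_cast congrArg (Int.cast (R := ZMod 3)) h)
  · simpa [cast_psi] using h4 a b c d (by exact_mod_cast congrArg (Int.cast (R := ZMod 4)) h)

lemma psi_T_mul {a b c d : ℤ} (h : a * d - b * c = 1) :
    12 ∣ psi (a + c) (b + d) c d - (psi a b c d + 1) := by
  have h3 : ∀ a b c d : ZMod 3, a * d - b * c = 1 →
      psi (a + c) (b + d) c d - (psi a b c d + 1) = 0 := by unfold psi; decide +kernel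
  have h4 : ∀ a b c d : ZMod 4, a * d - b * c = 1 →
      psi (a + c) (b + d) c d - (psi a b c d + 1) = 0 := by unfold psi; decide +kernel
  apply twelve_dvd_of_zmod
  · simpa [cast_psi] using h3 a b c d (by exact_mod_cast congrArg (Int.cast (R := ZMod 3)) h)
  · simpa [cast_psi] using h4 a b c d (by exact_mod_cast congrArg (Int.cast (R := ZMod 4)) h)

/-- The character of `SL(2, ℤ)` by which it acts on the weight 1 form `η ^ 2`. -/
noncomputable def etaSqChar (γ : SL(2, ℤ)) : ℂ :=
  zeta ^ (2 * psi (γ 0 0) (γ 0 1) (γ 1 0) (γ 1 1))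

lemma etaSqChar_one : etaSqChar 1 = 1 := by
  simp [etaSqChar, psi]

lemma det_eq_one (γ : SL(2, ℤ)) : γ 0 0 * γ 1 1 - γ 0 1 * γ 1 0 = 1 := by
  rw [← Matrix.det_fin_two, γ.det_coe]

lemma etaSqChar_S_mul (γ : SL(2, ℤ)) :
    etaSqChar (ModularGroup.S * γ) = -Complex.I * etaSqChar γ := by
  rw [← zeta_zpow_neg_six, etaSqChar, etaSqChar, ← zpow_add₀ zeta_ne_zero]
  apply zeta_zpow_congr
  have h := psi_S_mul (det_eq_one γ)
  simp only [Matrix.SpecialLinearGroup.coe_mul, ModularGroup.coe_S, Matrix.mul_apply,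
    Fin.sum_univ_two, Matrix.of_apply, Matrix.cons_val', Matrix.cons_val_zero,
    Matrix.cons_val_one, Matrix.cons_val_fin_one, zero_mul, one_mul, neg_mul, zero_add, add_zero]
  lia

lemma etaSqChar_T_mul (γ : SL(2, ℤ)) :
    etaSqChar (ModularGroup.T * γ) = zeta ^ (2 : ℤ) * etaSqChar γ := by
  rw [etaSqChar, etaSqChar, ← zpow_add₀ zeta_ne_zero]
  apply zeta_zpow_congr
  have h := psi_T_mul (det_eq_one γ)
  simp only [Matrix.SpecialLinearGroup.coe_mul, ModularGroup.coe_T, Matrix.mul_apply,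
    Fin.sum_univ_two, Matrix.of_apply, Matrix.cons_val', Matrix.cons_val_zero,
    Matrix.cons_val_one, Matrix.cons_val_fin_one, zero_mul, one_mul, zero_add]
  lia

/-- The square of the Dedekind eta function, as a function on the upper half plane. -/
noncomputable def etaSq (τ : ℍ) : ℂ := eta τ ^ 2

lemma etaSq_slash_T : etaSq ∣[(1 : ℤ)] ModularGroup.T = zeta ^ (2 : ℤ) • etaSq := by
  ext τ
  have h1 : Function.Periodic.qParam 1 (1 + τ : ℂ) = Function.Periodic.qParam 1 (τ : ℂ) := by
    simp [Function.Periodic.qParam, mul_add, Complex.exp_add, Complex.exp_two_pi_mul_I]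
  have h24 : Function.Periodic.qParam 24 (1 + τ : ℂ) =
      zeta * Function.Periodic.qParam 24 (τ : ℂ) := by
    simp [Function.Periodic.qParam, zeta, mul_add, add_div, Complex.exp_add]
  have hdenom : denom ModularGroup.T τ = 1 := by
    simp [ModularGroup.denom_apply, ModularGroup.coe_T]
  rw [SL_slash_apply, hdenom, modular_T_smul, one_zpow, mul_one, Pi.smul_apply, etaSq, etaSq]
  simp only [eta, eta_q, coe_vadd, Complex.ofReal_one, h1, h24, mul_pow, mul_assoc, smul_eq_mul,
    zpow_ofNat]

lemma sqrt_sq (z : ℂ) : Complex.sqrt z ^ 2 = z :=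
  mod_cast Complex.cpow_nat_inv_pow z two_ne_zero

lemma eta_neg_inv (τ : ℍ) :
    eta (-1 / (τ : ℂ)) = (Complex.sqrt Complex.I)⁻¹ * (Complex.sqrt τ * eta τ) := by
  simpa using eta_comp_eq_csqrt_I_inv τ.2

lemma etaSq_slash_S : etaSq ∣[(1 : ℤ)] ModularGroup.S = -Complex.I • etaSq := by
  ext τ
  have hτ : (τ : ℂ) ≠ 0 := τ.ne_zero
  have hdenom : denom ModularGroup.S τ = τ := by
    simp [ModularGroup.denom_apply, ModularGroup.coe_S]
  have hcoe : ((ModularGroup.S • τ : ℍ) : ℂ) = -1 / τ := by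
    rw [modular_S_smul, coe_mk, ← neg_inv, neg_div, one_div]
  rw [SL_slash_apply, hdenom, etaSq, hcoe, eta_neg_inv, mul_pow, mul_pow, inv_pow, sqrt_sq,
    sqrt_sq, Complex.inv_I, Pi.smul_apply, etaSq, zpow_neg_one, smul_eq_mul]
  field_simp

theorem etaSq_slash (γ : SL(2, ℤ)) : etaSq ∣[(1 : ℤ)] γ = etaSqChar γ • etaSq := by
  have generator {x : SL(2, ℤ)} (hx : x ∈ ({ModularGroup.S, ModularGroup.T} : Set SL(2, ℤ))) :
      ∃ χ : ℂ, χ ≠ 0 ∧ etaSq ∣[(1 : ℤ)] x = χ • etaSq ∧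
        ∀ γ, etaSqChar (x * γ) = χ * etaSqChar γ := by
    rcases hx with rfl | rfl
    · exact ⟨_, by simp, etaSq_slash_S, etaSqChar_S_mul⟩
    · exact ⟨_, zpow_ne_zero _ zeta_ne_zero, etaSq_slash_T, etaSqChar_T_mul⟩
  have hγ : γ ∈ Subgroup.closure {ModularGroup.S, ModularGroup.T} := by
    simp [SpecialLinearGroup.SL2Z_generators]
  induction hγ using Subgroup.closure_induction_left with
  | one => rw [SlashAction.slash_one, etaSqChar_one, one_smul]
  | mul_left x hx γ _ ih =>
    obtain ⟨χ, -, hslash, hchar⟩ := generator hx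
    rw [SlashAction.slash_mul, hslash, SL_smul_slash, ih, hchar, mul_smul]
  | inv_mul_cancel x hx γ _ ih =>
    obtain ⟨χ, hχ, hslash, hchar⟩ := generator hx
    have hinv : etaSq ∣[(1 : ℤ)] x⁻¹ = χ⁻¹ • etaSq := by
      rw [eq_inv_smul_iff₀ hχ, ← SL_smul_slash, ← hslash, ← SlashAction.slash_mul, mul_inv_cancel,
        SlashAction.slash_one]
    rw [SlashAction.slash_mul, hinv, SL_smul_slash, ih, smul_smul, ← mul_inv_cancel_left x γ,
      hchar, inv_mul_cancel_left, inv_mul_cancel_left₀ hχ]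

/-! ### Eta quotients for `Γ₀(N)` -/

lemma smul_coe (γ : SL(2, ℤ)) (τ : ℍ) :
    ((γ • τ : ℍ) : ℂ) = ((γ 0 0 : ℤ) * τ + (γ 0 1 : ℤ)) / ((γ 1 0 : ℤ) * τ + (γ 1 1 : ℤ)) := by
  simp only [coe_specialLinearGroup_apply, algebraMap_int_eq, eq_intCast, Complex.ofReal_intCast]

lemma coe_denom_ne_zero (γ : SL(2, ℤ)) (τ : ℍ) : (γ 1 0 : ℂ) * τ + γ 1 1 ≠ 0 := by
  simpa [ModularGroup.denom_apply] using UpperHalfPlane.denom_ne_zero (γ : GL (Fin 2) ℝ) τ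

lemma eta_sq_smul (γ : SL(2, ℤ)) (τ : ℍ) :
    eta (γ • τ : ℍ) ^ 2 = etaSqChar γ * (γ 1 0 * τ + γ 1 1) * eta τ ^ 2 := by
  have h := congrFun (etaSq_slash γ) τ
  rw [SL_slash_apply, zpow_neg_one, mul_inv_eq_iff_eq_mul₀ (UpperHalfPlane.denom_ne_zero _ τ),
    ModularGroup.denom_apply, Pi.smul_apply, smul_eq_mul, etaSq, etaSq] at h
  rw [h]
  ring

lemma exists_coe_eq_natCast_mul {δ : ℕ} (hδ : 0 < δ) (τ : ℍ) : ∃ w : ℍ, (w : ℂ) = δ * τ :=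
  ⟨⟨δ * τ, by simpa using mul_pos (Nat.cast_pos.2 hδ) τ.im_pos⟩, rfl⟩

lemma eta_natCast_mul_ne_zero {δ : ℕ} (hδ : 0 < δ) (τ : ℍ) : eta (δ * τ) ≠ 0 := by
  obtain ⟨w, hw⟩ := exists_coe_eq_natCast_mul hδ τ
  exact hw ▸ eta_ne_zero w.2

lemma differentiableAt_eta_natCast_mul {δ : ℕ} (hδ : 0 < δ) (τ : ℍ) :
    DifferentiableAt ℂ (fun z : ℂ => eta (δ * z)) τ := by
  obtain ⟨w, hw⟩ := exists_coe_eq_natCast_mul hδ τ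
  refine DifferentiableAt.comp (g := eta) _ ?_ (by fun_prop)
  exact hw ▸ differentiableAt_eta_of_mem_upperHalfPlaneSet w.2

lemma etaQuotient_nil (τ : ℍ) : etaQuotient [] τ = 1 := rfl

lemma etaQuotient_cons (p : ℕ × ℤ) (l : List (ℕ × ℤ)) (τ : ℍ) :
    etaQuotient (p :: l) τ = eta (p.1 * τ) ^ p.2 * etaQuotient l τ := rfl

lemma etaQuotient_append (l₁ l₂ : List (ℕ × ℤ)) (τ : ℍ) :
    etaQuotient (l₁ ++ l₂) τ = etaQuotient l₁ τ * etaQuotient l₂ τ := by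
  simp [etaQuotient]

/-- The exponents of the `n`th power of an `η`-quotient. -/
def scale (n : ℤ) (l : List (ℕ × ℤ)) : List (ℕ × ℤ) := l.map fun p => (p.1, n * p.2)

lemma etaQuotient_scale (n : ℤ) (l : List (ℕ × ℤ)) (τ : ℍ) :
    etaQuotient (scale n l) τ = etaQuotient l τ ^ n := by
  induction l with
  | nil => simp [scale, etaQuotient_nil]
  | cons p l ih =>
    rw [etaQuotient_cons, mul_zpow, ← zpow_mul, ← ih, mul_comm p.2]
    rfl

lemma etaQuotient_ne_zero {l : List (ℕ × ℤ)} (hl : ∀ p ∈ l, 0 < p.1) (τ : ℍ) :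
    etaQuotient l τ ≠ 0 := by
  refine List.prod_ne_zero fun h => ?_
  obtain ⟨p, hp, h0⟩ := List.mem_map.1 h
  exact zpow_ne_zero _ (eta_natCast_mul_ne_zero (hl p hp) τ) h0

lemma mdifferentiable_etaQuotient {l : List (ℕ × ℤ)} (hl : ∀ p ∈ l, 0 < p.1) :
    MDiff (etaQuotient l) := by
  rw [UpperHalfPlane.mdifferentiable_iff]
  have h : DifferentiableOn ℂ (fun z : ℂ => (l.map fun p => eta (p.1 * z) ^ p.2).prod)
      upperHalfPlaneSet := by
    induction l with
    | nil => exact differentiableOn_const 1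
    | cons p l ih =>
      rw [List.forall_mem_cons] at hl
      refine DifferentiableOn.mul (fun z hz => ?_) (ih hl.2)
      exact ((differentiableAt_eta_natCast_mul hl.1 ⟨z, hz⟩).zpow
        (.inl (eta_natCast_mul_ne_zero hl.1 ⟨z, hz⟩))).differentiableWithinAt
  refine h.congr fun z hz => ?_
  simp [etaQuotient, ofComplex_apply_of_im_pos hz]

/-- The weight of an `η`-quotient with even exponents. -/
def weight (l : List (ℕ × ℤ)) : ℤ := (l.map fun p : ℕ × ℤ => p.2 / 2).sum

/-- The sum `∑ δ * r` over the factors `η (δ τ) ^ r`, which is 24 times the order at infinity. -/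
def order (l : List (ℕ × ℤ)) : ℤ := (l.map fun p : ℕ × ℤ => (p.1 : ℤ) * p.2).sum

/-- The sum `∑ (N / δ) * r` over the factors `η (δ τ) ^ r`, which is 24 times the order of the
`η`-quotient at the cusp 0 of `Γ₀(N)`. -/
def coorder (N : ℕ) (l : List (ℕ × ℤ)) : ℤ := (l.map fun p : ℕ × ℤ => ((N / p.1 : ℕ) : ℤ) * p.2).sum

lemma weight_cons (p : ℕ × ℤ) (l : List (ℕ × ℤ)) : weight (p :: l) = p.2 / 2 + weight l := rfl

lemma order_cons (p : ℕ × ℤ) (l : List (ℕ × ℤ)) : order (p :: l) = p.1 * p.2 + order l := rfl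

lemma coorder_cons (N : ℕ) (p : ℕ × ℤ) (l : List (ℕ × ℤ)) :
    coorder N (p :: l) = (N / p.1 : ℕ) * p.2 + coorder N l := rfl

/-- The matrix `(a, δ b; c / δ, d)` conjugates `γ = (a, b; c, d)` through multiplication by `δ`. -/
lemma eta_natCast_mul_smul_sq (γ : SL(2, ℤ)) {δ : ℕ} (hδ : 0 < δ) {c : ℤ} (hc : γ 1 0 = δ * c)
    (τ : ℍ) :
    eta (δ * (γ • τ : ℍ)) ^ 2 =
      zeta ^ (2 * psi (γ 0 0) (δ * γ 0 1) c (γ 1 1)) * (γ 1 0 * τ + γ 1 1) * eta (δ * τ) ^ 2 := by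
  have hdet := det_eq_one γ
  let σ : SL(2, ℤ) := ⟨!![γ 0 0, δ * γ 0 1; c, γ 1 1], by
    rw [Matrix.det_fin_two_of]; linear_combination hdet + γ 0 1 * hc⟩
  obtain ⟨w, hw⟩ := exists_coe_eq_natCast_mul hδ τ
  have hσ : ((σ • w : ℍ) : ℂ) = δ * (γ • τ : ℍ) := by
    rw [smul_coe, smul_coe, hw, hc, ← mul_div_assoc]
    congr 1 <;> simp [σ] <;> ring
  rw [← hσ, eta_sq_smul, hw, hc]
  simp only [etaSqChar, σ, Matrix.of_apply, Matrix.cons_val', Matrix.cons_val_zero,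
    Matrix.cons_val_one, Matrix.cons_val_fin_one]
  push_cast
  ring

/-- The exponent of `zeta` in the transformation law of the `η`-quotient with exponents `l` under
`(a, b; N * c, d)`. -/
def phase (N : ℕ) (l : List (ℕ × ℤ)) (a b c d : ℤ) : ℤ :=
  b * d * order l + ((a + 3) * (1 - d ^ 2) - d) * c * coorder N l +
    6 * (d - 1) * (d - 2) * weight l

lemma phase_cons (N δ : ℕ) (k : ℤ) (l : List (ℕ × ℤ)) (a b c d : ℤ) :
    phase N ((δ, 2 * k) :: l) a b c d =
      2 * psi a (δ * b) ((N / δ : ℕ) * c) d * k + phase N l a b c d := by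
  simp only [phase, psi, order_cons, coorder_cons, weight_cons,
    Int.mul_ediv_cancel_left k two_ne_zero]
  ring

lemma etaQuotient_smul {N : ℕ} (hN : 0 < N) {l : List (ℕ × ℤ)} (hdvd : ∀ p ∈ l, p.1 ∣ N)
    (heven : ∀ p ∈ l, Even p.2) {γ : SL(2, ℤ)} {c : ℤ} (hc : γ 1 0 = N * c) (τ : ℍ) :
    etaQuotient l (γ • τ) = zeta ^ phase N l (γ 0 0) (γ 0 1) c (γ 1 1) *
      (γ 1 0 * τ + γ 1 1) ^ weight l * etaQuotient l τ := by
  induction l with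
  | nil => simp [phase, order, coorder, weight, etaQuotient_nil]
  | cons p l ih =>
    obtain ⟨δ, r⟩ := p
    rw [List.forall_mem_cons] at hdvd heven
    obtain ⟨k, rfl⟩ := heven.1.two_dvd
    have hδ := Nat.pos_of_dvd_of_pos hdvd.1 hN
    have hγ : γ 1 0 = δ * ((N / δ : ℕ) * c) := by
      rw [hc, ← mul_assoc, ← Nat.cast_mul, Nat.mul_div_cancel' hdvd.1]
    rw [etaQuotient_cons, etaQuotient_cons, ih hdvd.2 heven.2, zpow_mul, zpow_ofNat,
      eta_natCast_mul_smul_sq γ hδ hγ, mul_zpow, mul_zpow, ← zpow_mul zeta, zpow_mul _ 2 k,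
      zpow_ofNat, weight_cons, Int.mul_ediv_cancel_left k two_ne_zero,
      zpow_add₀ (coe_denom_ne_zero γ τ), phase_cons, zpow_add₀ zeta_ne_zero]
    ring

/-- The Gordon–Hughes–Newman criterion for even exponents. -/
lemma etaQuotient_smul_of_dvd {N : ℕ} (hN : 0 < N) {l : List (ℕ × ℤ)}
    (hdvd : ∀ p ∈ l, p.1 ∣ N) (heven : ∀ p ∈ l, Even p.2) (hweight : weight l = 0)
    (horder : 24 ∣ order l) (hcoorder : 24 ∣ coorder N l) {γ : SL(2, ℤ)} (hγ : (N : ℤ) ∣ γ 1 0)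
    (τ : ℍ) : etaQuotient l (γ • τ) = etaQuotient l τ := by
  obtain ⟨c, hc⟩ := hγ
  rw [etaQuotient_smul hN hdvd heven hc, phase, hweight, mul_zero, add_zero, zpow_zero,
    mul_one, zeta_zpow_eq_one (dvd_add (horder.mul_left _) (hcoorder.mul_left _)), one_mul]

lemma norm_zeta : ‖zeta‖ = 1 := by
  rw [zeta, show 2 * (Real.pi : ℂ) * Complex.I / 24 = ((2 * Real.pi / 24 : ℝ) : ℂ) * Complex.I by
    push_cast; ring, Complex.norm_exp_ofReal_mul_I]

/-- The Petersson norm of `η ^ 2` is invariant. -/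
lemma norm_eta_smul_pow_four_mul_im (γ : SL(2, ℤ)) (τ : ℍ) :
    ‖eta (γ • τ : ℍ)‖ ^ 4 * (γ • τ).im = ‖eta τ‖ ^ 4 * τ.im := by
  have h := congrArg (fun z => ‖z‖ ^ 2) (eta_sq_smul γ τ)
  simp only [norm_mul, norm_pow, etaSqChar, norm_zpow, norm_zeta, one_zpow, one_mul, mul_pow,
    ← pow_mul] at h
  have hden : Complex.normSq ((γ 1 0 : ℤ) * τ + (γ 1 1 : ℤ)) ≠ 0 := by
    simpa using coe_denom_ne_zero γ τ
  rw [h, ModularGroup.im_smul_eq_div_normSq, ModularGroup.denom_apply, ← Complex.normSq_eq_norm_sq]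
  field_simp

/-! ### Orders at the cusps -/

lemma exists_bottom_row_eq_div_gcd {δ : ℕ} (hδ : 0 < δ) (γ : SL(2, ℤ)) :
    ∃ (σ : SL(2, ℤ)) (c ε : ℤ), γ 1 0 = (γ 1 0).gcd δ * c ∧ (δ : ℤ) = (γ 1 0).gcd δ * ε ∧
      σ 1 0 = -c ∧ σ 1 1 = ε * γ 0 0 := by
  set g := (γ 1 0).gcd δ
  have hg : 0 < g := Int.gcd_pos_of_ne_zero_right _ (by lia)
  obtain ⟨c, hc⟩ : (g : ℤ) ∣ γ 1 0 := Int.gcd_dvd_left _ _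
  obtain ⟨ε, hε⟩ : (g : ℤ) ∣ δ := Int.gcd_dvd_right _ _
  have hcε : IsCoprime c ε := by
    refine ⟨(γ 1 0).gcdA δ, (γ 1 0).gcdB δ, mul_left_cancel₀ (Nat.cast_ne_zero.2 hg.ne') ?_⟩
    linear_combination -Int.gcd_eq_gcd_ab (γ 1 0) δ - (γ 1 0).gcdA δ * hc - (γ 1 0).gcdB δ * hε
  have hca : IsCoprime c (γ 0 0) :=
    ⟨-(g * γ 0 1), γ 1 1, by linear_combination det_eq_one γ + γ 0 1 * hc⟩
  obtain ⟨σ, -, hσ⟩ := ModularGroup.bottom_row_surj (R := ℤ) (a := ![-c, ε * γ 0 0])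
    (hcε.mul_right hca).neg_left
  exact ⟨σ, c, ε, hc, hε, congrFun hσ 0, congrFun hσ 1⟩

/-- The matrix `(δ, 0; 0, 1) * γ` is brought to upper triangular form by `SL(2, ℤ)` from the left,
with `gcd (γ 1 0) δ` on the diagonal. -/
lemma exists_smul_eq_gcd_mul {δ : ℕ} (hδ : 0 < δ) (γ : SL(2, ℤ)) :
    ∃ (σ : SL(2, ℤ)) (j : ℤ), ∀ τ w : ℍ, (w : ℂ) = δ * (γ • τ : ℍ) →
      ((σ • w : ℍ) : ℂ) = (γ 1 0).gcd δ / δ * ((γ 1 0).gcd δ * τ + j) := by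
  obtain ⟨σ, c, ε, hc, hε, hσ0, hσ1⟩ := exists_bottom_row_eq_div_gcd hδ γ
  have hγdet : (γ 0 0 * γ 1 1 - γ 0 1 * γ 1 0 : ℂ) = 1 := mod_cast det_eq_one γ
  have hσdet : (σ 0 0 * (ε * γ 0 0) - σ 0 1 * -c : ℂ) = 1 := by
    exact_mod_cast hσ0 ▸ hσ1 ▸ det_eq_one σ
  set g := (γ 1 0).gcd δ
  refine ⟨σ, σ 0 0 * δ * γ 0 1 + σ 0 1 * γ 1 1, fun τ w hw => ?_⟩
  have hδC : (δ : ℂ) = g * ε := mod_cast hε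
  have hcC : (γ 1 0 : ℂ) = g * c := mod_cast hc
  obtain ⟨hg0, hε0⟩ : (g : ℂ) ≠ 0 ∧ (ε : ℂ) ≠ 0 := by
    rw [← mul_ne_zero_iff, ← hδC]
    exact_mod_cast hδ.ne'
  have hden := coe_denom_ne_zero γ τ
  rw [smul_coe, hw, smul_coe, hσ0, hσ1]
  generalize (τ : ℂ) = z at hden
  have hnumer : σ 0 0 * (δ * (γ 0 0 * z + γ 0 1)) + σ 0 1 * (γ 1 0 * z + γ 1 1) =
      g * z + (σ 0 0 * δ * γ 0 1 + σ 0 1 * γ 1 1) := by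
    linear_combination σ 0 0 * γ 0 0 * z * hδC + σ 0 1 * z * hcC + g * z * hσdet
  have hdenom : -c * (δ * (γ 0 0 * z + γ 0 1)) + ε * γ 0 0 * (γ 1 0 * z + γ 1 1) = ε := by
    linear_combination -c * (γ 0 0 * z + γ 0 1) * hδC + ε * (γ 0 0 * z + γ 0 1) * hcC +
      ε * hγdet
  have hfrac (x y : ℂ) : x * (δ * ((γ 0 0 * z + γ 0 1) / (γ 1 0 * z + γ 1 1))) + y =
      (x * (δ * (γ 0 0 * z + γ 0 1)) + y * (γ 1 0 * z + γ 1 1)) / (γ 1 0 * z + γ 1 1) := by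
    rw [← mul_div_assoc, ← mul_div_assoc, div_add' _ _ _ hden]
  push_cast
  rw [hfrac, hfrac, div_div_div_cancel_right₀ hden, hnumer, hdenom, hδC]
  field_simp

/-- The product `∏ (1 - q ^ n)` over the positive integers `n`. -/
noncomputable def euler (q : ℂ) : ℂ := ∏' n : ℕ, (1 - q ^ (n + 1))

lemma tendsto_euler : Tendsto euler (𝓝 0) (𝓝 1) := by
  have h : ContinuousAt euler 0 := (differentiableOn_tprod_one_sub_pow.differentiableAt
    (Metric.ball_mem_nhds (0 : ℂ) one_pos)).continuousAt
  simpa [ContinuousAt, euler] using h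

/-- The nome `exp (2 π i τ)`. -/
noncomputable def nome (τ : ℍ) : ℂ := Complex.exp (2 * Real.pi * Complex.I * τ)

lemma tendsto_nome : Tendsto nome atImInfty (𝓝 0) := by
  refine Tendsto.congr (fun τ => ?_) <| UpperHalfPlane.qParam_tendsto_atImInfty one_pos
  simp [nome, Function.Periodic.qParam]

lemma eta_natCast_mul (δ : ℕ) (τ : ℍ) :
    eta (δ * τ) = Complex.exp (2 * Real.pi * Complex.I * τ / 24) ^ δ * euler (nome τ ^ δ) := by
  rw [nome, ← Complex.exp_nat_mul, ← Complex.exp_nat_mul]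
  simp only [eta, euler, Function.Periodic.qParam, eta_q, Complex.ofReal_one, div_one]
  push_cast
  ring_nf

lemma norm_eta_isTheta :
    (fun τ : ℍ => ‖eta τ‖ ^ 4) =Θ[atImInfty] fun τ : ℍ => Real.exp (-(Real.pi / 3) * τ.im) := by
  have h : Tendsto (fun τ : ℍ => ‖euler (nome τ)‖ ^ 4) atImInfty (𝓝 1) := by
    simpa using ((tendsto_euler.comp tendsto_nome).norm).pow 4
  refine (isTheta_of_div_tendsto_nhds_ne_zero (h.congr fun τ => ?_) one_ne_zero).symm
  have hη := eta_natCast_mul 1 τ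
  rw [Nat.cast_one, one_mul, pow_one, pow_one] at hη
  rw [eq_div_iff (Real.exp_pos _).ne', hη, norm_mul, mul_pow, Complex.norm_exp,
    ← Real.exp_nat_mul, mul_comm]
  congr 2
  simp
  ring

lemma norm_eta_comp_isTheta {κ : ℝ} (hκ : 0 < κ) {w : ℍ → ℍ} (hw : ∀ τ, (w τ).im = κ * τ.im) :
    (fun τ => ‖eta (w τ)‖ ^ 4) =Θ[atImInfty] fun τ => Real.exp (-(Real.pi / 3) * (κ * τ.im)) := by
  have htendsto : Tendsto w atImInfty atImInfty := by
    rw [atImInfty, tendsto_comap_iff]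
    exact (tendsto_comap.const_mul_atTop hκ).congr fun τ => (hw τ).symm
  simp only [← hw]
  exact ⟨norm_eta_isTheta.1.comp_tendsto htendsto, norm_eta_isTheta.2.comp_tendsto htendsto⟩

lemma norm_eta_natCast_mul_smul_isTheta (γ : SL(2, ℤ)) {δ : ℕ} (hδ : 0 < δ) :
    (fun τ : ℍ => ‖eta (δ * (γ • τ : ℍ))‖ ^ 4 * (γ • τ).im) =Θ[atImInfty]
      fun τ : ℍ => Real.exp (-(Real.pi / 3) * (((γ 1 0).gcd δ : ℝ) ^ 2 / δ * τ.im)) * τ.im := by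
  obtain ⟨σ, j, hσ⟩ := exists_smul_eq_gcd_mul hδ γ
  set g := (γ 1 0).gcd δ
  have : 0 < g := Int.gcd_pos_of_ne_zero_right _ (by lia)
  choose w hw using fun τ : ℍ => exists_coe_eq_natCast_mul hδ (γ • τ)
  have him (τ : ℍ) : (σ • w τ).im = (g : ℝ) ^ 2 / δ * τ.im := by
    have h : ((σ • w τ : ℍ) : ℂ) = ((g ^ 2 / δ : ℝ) : ℂ) * τ + ((g / δ * j : ℝ) : ℂ) := by
      rw [hσ τ (w τ) (hw τ)]
      push_cast
      ring
    rw [← coe_im, h, Complex.add_im, Complex.im_ofReal_mul, Complex.ofReal_im, add_zero, coe_im]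
  have him' (τ : ℍ) : (w τ).im = δ * (γ • τ).im := by
    simpa using congrArg Complex.im (hw τ)
  have hnorm (τ : ℍ) : ‖eta (δ * (γ • τ : ℍ))‖ ^ 4 * (γ • τ).im =
      (g : ℝ) ^ 2 / δ / δ * (‖eta (σ • w τ : ℍ)‖ ^ 4 * τ.im) := by
    have h := norm_eta_smul_pow_four_mul_im σ (w τ)
    rw [him, him', hw] at h
    field_simp at h ⊢
    linear_combination -h
  simp only [hnorm]
  rw [isTheta_const_mul_left (by positivity)]
  exact (norm_eta_comp_isTheta (by positivity) him).mul (isTheta_refl _ _)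

/-- The sum `∑ gcd (c, δ) ^ 2 * (N / δ) * r` over the factors `η (δ τ) ^ r`, which up to a positive
factor is the order of the `η`-quotient at the cusps `a / c`. -/
def cuspOrder (N : ℕ) (l : List (ℕ × ℤ)) (c : ℤ) : ℤ :=
  (l.map fun p : ℕ × ℤ => ((c.gcd p.1 ^ 2 * (N / p.1) : ℕ) : ℤ) * p.2).sum

lemma cuspOrder_cons (N : ℕ) (p : ℕ × ℤ) (l : List (ℕ × ℤ)) (c : ℤ) :
    cuspOrder N (p :: l) c = (c.gcd p.1 ^ 2 * (N / p.1) : ℕ) * p.2 + cuspOrder N l c := rfl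

lemma norm_etaQuotient_smul_isTheta {N : ℕ} (hN : 0 < N) {l : List (ℕ × ℤ)}
    (hdvd : ∀ p ∈ l, p.1 ∣ N) (heven : ∀ p ∈ l, Even p.2) (γ : SL(2, ℤ)) :
    (fun τ : ℍ => ‖etaQuotient l (γ • τ)‖ ^ 4 * (γ • τ).im ^ (2 * weight l)) =Θ[atImInfty]
      fun τ : ℍ => Real.exp (-(Real.pi / 3) * (cuspOrder N l (γ 1 0) / N * τ.im)) *
        τ.im ^ (2 * weight l) := by
  induction l with
  | nil => simp [weight, cuspOrder, etaQuotient_nil]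
  | cons p l ih =>
    obtain ⟨δ, r⟩ := p
    rw [List.forall_mem_cons] at hdvd heven
    obtain ⟨⟨k, rfl⟩, m, rfl⟩ := And.intro heven.1.two_dvd hdvd.1
    obtain ⟨hδ, hm⟩ : 0 < δ ∧ 0 < m := CanonicallyOrderedAdd.mul_pos.1 hN
    have hleft (τ : ℍ) : ‖etaQuotient ((δ, 2 * k) :: l) τ‖ ^ 4 * τ.im ^ (2 * (k + weight l)) =
        (‖eta (δ * τ)‖ ^ 4 * τ.im) ^ (2 * k) * (‖etaQuotient l τ‖ ^ 4 * τ.im ^ (2 * weight l)) := by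
      rw [etaQuotient_cons, mul_add 2 k, zpow_add₀ τ.im_ne_zero, norm_mul, norm_zpow, mul_zpow,
        mul_pow, ← zpow_natCast (_ ^ (2 * k)), zpow_comm, zpow_natCast, mul_mul_mul_comm]
    have hright (τ : ℍ) :
        Real.exp (-(Real.pi / 3) *
          (cuspOrder (δ * m) ((δ, 2 * k) :: l) (γ 1 0) / (δ * m : ℕ) * τ.im)) *
            τ.im ^ (2 * (k + weight l)) =
          (Real.exp (-(Real.pi / 3) * (((γ 1 0).gcd δ : ℝ) ^ 2 / δ * τ.im)) * τ.im) ^ (2 * k) *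
            (Real.exp (-(Real.pi / 3) * (cuspOrder (δ * m) l (γ 1 0) / (δ * m : ℕ) * τ.im)) *
              τ.im ^ (2 * weight l)) := by
      rw [cuspOrder_cons, mul_add 2 k, zpow_add₀ τ.im_ne_zero, mul_zpow, mul_mul_mul_comm,
        ← Real.rpow_intCast (Real.exp _), ← Real.exp_mul, ← Real.exp_add,
        Nat.mul_div_cancel_left _ hδ]
      congr 2
      push_cast
      field_simp
      ring
    simp only [weight_cons, Int.mul_ediv_cancel_left k two_ne_zero, hleft, hright]
    exact ((norm_eta_natCast_mul_smul_isTheta γ hδ).zpow (2 * k)).mul (ih hdvd.2 heven.2)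

lemma isBoundedAtImInfty_etaQuotient_smul {N : ℕ} (hN : 0 < N) {l : List (ℕ × ℤ)}
    (hdvd : ∀ p ∈ l, p.1 ∣ N) (heven : ∀ p ∈ l, Even p.2) (hweight : weight l = 0)
    {γ : SL(2, ℤ)} (hγ : 0 ≤ cuspOrder N l (γ 1 0)) :
    IsBoundedAtImInfty fun τ => etaQuotient l (γ • τ) := by
  have h := (norm_etaQuotient_smul_isTheta hN hdvd heven γ).1
  simp only [hweight, mul_zero, zpow_zero, mul_one] at h
  have hexp : (fun τ : ℍ => Real.exp (-(Real.pi / 3) * (cuspOrder N l (γ 1 0) / N * τ.im)))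
      =O[atImInfty] fun _ => (1 : ℝ) ^ 4 := by
    refine .of_bound 1 (.of_forall fun τ => ?_)
    have hpos : 0 ≤ Real.pi / 3 * (cuspOrder N l (γ 1 0) / N * τ.im) := by positivity
    rw [Real.norm_of_nonneg (Real.exp_pos _).le, one_pow, norm_one, mul_one, Real.exp_le_one_iff]
    linarith
  exact ((h.trans hexp).of_pow four_ne_zero).of_norm_left

/-! ### `q`-expansions -/

/-- The value at `q` of the polynomial with the list of coefficients `p`, the constant coefficient
coming first. Polynomials are encoded by lists so that the kernel can compute with them. -/
noncomputable def eval (p : List ℤ) (q : ℂ) : ℂ := p.foldr (fun a x => a + q * x) 0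

lemma eval_nil (q : ℂ) : eval [] q = 0 := rfl

lemma eval_cons (a : ℤ) (p : List ℤ) (q : ℂ) : eval (a :: p) q = a + q * eval p q := rfl

/-- The sum of two polynomials. -/
def add : List ℤ → List ℤ → List ℤ
  | [], r => r
  | p, [] => p
  | a :: p, b :: r => (a + b) :: add p r

/-- The product of two polynomials. -/
def mul : List ℤ → List ℤ → List ℤ
  | [], _ => []
  | a :: p, r => add (r.map (a * ·)) (0 :: mul p r)

/-- The polynomial `p (X ^ δ)`, for positive `δ`. -/
def expand (δ : ℕ) (p : List ℤ) : List ℤ := p.flatMap fun a => a :: List.replicate (δ - 1) 0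

lemma eval_add (p r : List ℤ) (q : ℂ) : eval (add p r) q = eval p q + eval r q := by
  fun_induction add p r with
  | case1 => simp [eval_nil]
  | case2 => simp [eval_nil]
  | case3 a p b r ih =>
    simp only [eval_cons, ih]
    push_cast
    ring

lemma eval_map_mul (c : ℤ) (p : List ℤ) (q : ℂ) : eval (p.map (c * ·)) q = c * eval p q := by
  induction p with
  | nil => simp [eval_nil]
  | cons a p ih =>
    simp only [List.map_cons, eval_cons, ih]
    push_cast
    ring

lemma eval_mul (p r : List ℤ) (q : ℂ) : eval (mul p r) q = eval p q * eval r q := by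
  induction p with
  | nil => simp [mul, eval_nil]
  | cons a p ih =>
    simp only [mul, eval_add, eval_map_mul, eval_cons, ih]
    push_cast
    ring

lemma eval_replicate_append (n : ℕ) (p : List ℤ) (q : ℂ) :
    eval (List.replicate n 0 ++ p) q = q ^ n * eval p q := by
  induction n with
  | zero => simp
  | succ n ih =>
    rw [List.replicate_succ, List.cons_append, eval_cons, ih, Int.cast_zero, pow_succ']
    ring

lemma eval_expand {δ : ℕ} (hδ : 0 < δ) (p : List ℤ) (q : ℂ) :
    eval (expand δ p) q = eval p (q ^ δ) := by
  induction p with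
  | nil => rfl
  | cons a p ih =>
    rw [expand, List.flatMap_cons, List.cons_append, eval_cons, eval_replicate_append, eval_cons,
      ← ih, ← mul_assoc, mul_pow_sub_one hδ.ne', expand]

lemma eval_eq_take_add_drop (K : ℕ) (p : List ℤ) (q : ℂ) :
    eval p q = eval (p.take K) q + q ^ K * eval (p.drop K) q := by
  induction K generalizing p with
  | zero => simp [eval_nil]
  | succ K ih =>
    cases p with
    | nil => simp [eval_nil]
    | cons a p =>
      rw [List.take_succ_cons, List.drop_succ_cons, eval_cons, eval_cons, ih p]
      ring

lemma eval_eq_zero {p : List ℤ} (hp : ∀ a ∈ p, a = 0) (q : ℂ) : eval p q = 0 := by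
  induction p with
  | nil => rfl
  | cons a p ih =>
    rw [List.forall_mem_cons] at hp
    rw [eval_cons, hp.1, ih hp.2, Int.cast_zero, mul_zero, add_zero]

lemma continuous_eval (p : List ℤ) : Continuous (eval p) := by
  induction p with
  | nil => exact continuous_const
  | cons a p ih => exact continuous_const.add (continuous_id.mul ih)

lemma eval_isBigO_one (p : List ℤ) : eval p =O[𝓝 0] fun _ => (1 : ℂ) :=
  (continuous_eval p).continuousAt.isBigO_one ℂ

lemma pow_isBigO_one (K : ℕ) : (fun q : ℂ => q ^ K) =O[𝓝 0] fun _ => (1 : ℂ) :=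
  (continuous_pow K).continuousAt.isBigO_one ℂ

lemma pow_isBigO_pow {m n : ℕ} (h : m ≤ n) :
    (fun q : ℂ => q ^ n) =O[𝓝 0] fun q => q ^ m := by
  have hmul := (isBigO_refl (fun q : ℂ => q ^ m) (𝓝 0)).mul (pow_isBigO_one (n - m))
  simpa only [← pow_add, Nat.add_sub_of_le h, mul_one] using hmul

/-- `f` agrees with the polynomial `p` up to `O(q ^ K)` at zero. -/
def Approx (K : ℕ) (f : ℂ → ℂ) (p : List ℤ) : Prop :=
  (fun q => f q - eval p q) =O[𝓝 0] fun q => q ^ K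

namespace Approx

variable {K : ℕ} {f g : ℂ → ℂ} {p r : List ℤ}

lemma isBigO_one (hf : Approx K f p) : f =O[𝓝 0] fun _ => (1 : ℂ) :=
  ((hf.trans (pow_isBigO_one K)).add (eval_isBigO_one p)).congr_left fun _ => sub_add_cancel _ _

lemma of_eq (h : ∀ q, f q = eval p q) : Approx K f p := by
  simpa [Approx, h] using isBigO_zero _ _

lemma one : Approx K (fun _ => 1) [1] := of_eq fun q => by simp [eval_cons, eval_nil]

lemma take (hf : Approx K f p) : Approx K f (p.take K) := by
  have h := (isBigO_refl (fun q : ℂ => q ^ K) (𝓝 0)).mul (eval_isBigO_one (p.drop K))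
  simp only [mul_one] at h
  refine (IsBigO.add hf h).congr_left fun q => ?_
  rw [eval_eq_take_add_drop K p q]
  ring

lemma add (hf : Approx K f p) (hg : Approx K g r) :
    Approx K (fun q => f q + g q) (add p r) :=
  (IsBigO.add hf hg).congr_left fun q => by rw [eval_add]; ring

lemma const_mul (hf : Approx K f p) (c : ℤ) : Approx K (fun q => c * f q) (p.map (c * ·)) :=
  (hf.const_mul_left (c : ℂ)).congr_left fun q => by rw [eval_map_mul]; ring

lemma shift (hf : Approx K f p) (n : ℕ) :
    Approx K (fun q => q ^ n * f q) (List.replicate n 0 ++ p) := by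
  have h := (pow_isBigO_one n).mul hf
  simp only [one_mul] at h
  exact h.congr_left fun q => by rw [eval_replicate_append]; ring

lemma mul (hf : Approx K f p) (hg : Approx K g r) :
    Approx K (fun q => f q * g q) ((mul p r).take K) := by
  apply take
  have hfg := IsBigO.mul hf hg.isBigO_one
  have hpg := (eval_isBigO_one p).mul hg
  simp only [mul_one, one_mul] at hfg hpg
  exact (hfg.add hpg).congr_left fun q => by rw [eval_mul]; ring

lemma comp_pow (hf : Approx K f p) {δ : ℕ} (hδ : 0 < δ) :
    Approx K (fun q => f (q ^ δ)) (expand δ p) := by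
  have htendsto : Tendsto (fun q : ℂ => q ^ δ) (𝓝 0) (𝓝 0) := by
    simpa [hδ.ne'] using (continuous_pow δ).tendsto (0 : ℂ)
  have hpow : (fun q : ℂ => (q ^ δ) ^ K) =O[𝓝 0] fun q => q ^ K := by
    have h := ((pow_isBigO_one (δ - 1)).mul (isBigO_refl (fun q : ℂ => q) (𝓝 0))).pow K
    simpa only [one_mul, pow_sub_one_mul hδ.ne'] using h
  refine ((IsBigO.comp_tendsto hf htendsto).trans hpow).congr_left fun q => ?_
  rw [Function.comp_apply, eval_expand hδ]

lemma mono (hf : Approx K f p) {n : ℕ} (hn : n ≤ K) : Approx n f p :=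
  IsBigO.trans hf (pow_isBigO_pow hn)

end Approx

/-- The `n`-th power of `p`, truncated to `K` coefficients. -/
def truncPow (K : ℕ) (p : List ℤ) : ℕ → List ℤ
  | 0 => [1]
  | n + 1 => (mul p (truncPow K p n)).take K

/-- The inverse of a power series `p` with constant coefficient `1`, truncated to `K`
coefficients: if `r` is the inverse modulo `q ^ K`, then `1 + (1 - p) * r` is the inverse modulo
`q ^ (K + 1)`. -/
def truncInv (p : List ℤ) : ℕ → List ℤ
  | 0 => []
  | K + 1 => (add [1] (mul (add [1] (p.map (-1 * ·))) (truncInv p K))).take (K + 1)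

namespace Approx

variable {K : ℕ} {f : ℂ → ℂ} {p : List ℤ}

lemma pow (hf : Approx K f p) (n : ℕ) : Approx K (fun q => f q ^ n) (truncPow K p n) := by
  induction n with
  | zero => simpa [truncPow] using one
  | succ n ih =>
    simp only [pow_succ']
    exact hf.mul ih

lemma inv (hf : Approx K f p) (hone : (fun q => 1 - f q) =O[𝓝 0] fun q => q) :
    Approx K (fun q => (f q)⁻¹) (truncInv p K) := by
  have htendsto : Tendsto f (𝓝 0) (𝓝 1) := by
    simpa using (hone.trans_tendsto tendsto_id).const_sub 1
  have hinv := (htendsto.inv₀ one_ne_zero).isBigO_one ℂ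
  suffices ∀ n ≤ K, Approx n (fun q => (f q)⁻¹) (truncInv p n) from this K le_rfl
  intro n hn
  induction n with
  | zero => simpa [Approx, truncInv, eval_nil] using hinv
  | succ n ih =>
    refine take ?_
    have hfirst := hone.mul (ih (by lia))
    have hsecond := (hf.mono hn).neg_left.mul (eval_isBigO_one (truncInv p n))
    simp only [mul_one, ← pow_succ'] at hfirst hsecond
    refine (hfirst.add hsecond).congr' ?_ EventuallyEq.rfl
    filter_upwards [htendsto.eventually_ne one_ne_zero] with q hq
    simp only [eval_add, eval_mul, eval_map_mul, eval_cons, eval_nil]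
    field_simp
    push_cast
    ring

end Approx

lemma norm_tprod_one_add_sub_one_le {ι : Type*} {f : ι → ℂ} (hf : Summable fun i => ‖f i‖) :
    ‖∏' i, (1 + f i) - 1‖ ≤ Real.exp (∑' i, ‖f i‖) - 1 := by
  refine le_of_tendsto ((multipliable_one_add_of_summable hf).hasProd.sub_const 1).norm
    (.of_forall fun s => (s.norm_prod_one_add_sub_one_le f).trans ?_)
  gcongr
  exact hf.sum_le_tsum s fun _ _ => norm_nonneg _

lemma hasSum_norm_pow_tail (K : ℕ) {q : ℂ} (hq : ‖q‖ < 1) :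
    HasSum (fun n : ℕ => ‖-q ^ (n + K + 1)‖) (‖q‖ ^ (K + 1) * (1 - ‖q‖)⁻¹) := by
  refine ((hasSum_geometric_of_lt_one (norm_nonneg q) hq).mul_left (‖q‖ ^ (K + 1))).congr_fun ?_
  intro n
  rw [norm_neg, norm_pow]
  ring

lemma tprod_tail_sub_one_isBigO (K : ℕ) :
    (fun q : ℂ => ∏' n : ℕ, (1 - q ^ (n + K + 1)) - 1) =O[𝓝 0] fun q => q ^ (K + 1) := by
  set s : ℂ → ℝ := fun q => ‖q‖ ^ (K + 1) * (1 - ‖q‖)⁻¹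
  have hcont : ContinuousAt (fun q : ℂ => (1 - ‖q‖)⁻¹) 0 :=
    (continuous_const.sub continuous_norm).continuousAt.inv₀ (by simp)
  have hs : s =O[𝓝 0] fun q => q ^ (K + 1) := by
    have h := (isBigO_refl (fun q : ℂ => q ^ (K + 1)) (𝓝 0)).norm_left.mul (hcont.isBigO_one ℂ)
    simpa only [norm_pow, mul_one] using h
  have hs_zero : Tendsto s (𝓝 0) (𝓝 0) := hs.trans_tendsto (by
    simpa using (continuous_pow (K + 1)).tendsto (0 : ℂ))
  have hexp : (fun q => Real.exp (s q) - 1) =O[𝓝 0] s := by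
    simpa [Function.comp_def] using (Real.hasDerivAt_exp 0).isBigO_sub.comp_tendsto hs_zero
  refine (IsBigO.of_bound 1 ?_).trans (hexp.trans hs)
  filter_upwards [Metric.ball_mem_nhds (0 : ℂ) one_pos] with q hq
  have hsum := hasSum_norm_pow_tail K (by simpa using hq)
  have h := norm_tprod_one_add_sub_one_le hsum.summable
  rw [hsum.tsum_eq] at h
  rw [one_mul, Real.norm_eq_abs]
  simpa only [← sub_eq_add_neg] using h.trans (le_abs_self _)

/-- The product of `1 - X ^ (i + 1)` over `i < n`, truncated to `K` coefficients. -/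
def eulerSeries (K : ℕ) : ℕ → List ℤ
  | 0 => [1]
  | n + 1 => (mul (eulerSeries K n) (1 :: (List.replicate n 0 ++ [-1]))).take K

lemma approx_prod_one_sub_pow (K n : ℕ) :
    Approx K (fun q => ∏ i ∈ Finset.range n, (1 - q ^ (i + 1))) (eulerSeries K n) := by
  induction n with
  | zero => simpa [eulerSeries] using Approx.one
  | succ n ih =>
    simp only [Finset.prod_range_succ]
    refine ih.mul (.of_eq fun q => ?_)
    simp only [eval_cons, eval_replicate_append, eval_nil]
    push_cast
    ring

lemma one_sub_euler_isBigO : (fun q => 1 - euler q) =O[𝓝 0] fun q => q := by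
  simpa [euler] using (tprod_tail_sub_one_isBigO 0).neg_left

lemma approx_euler (K : ℕ) : Approx K euler (eulerSeries K K) := by
  have hprod := approx_prod_one_sub_pow K K
  have htail := ((tprod_tail_sub_one_isBigO K).trans (pow_isBigO_pow K.le_succ)).mul
    hprod.isBigO_one
  simp only [mul_one] at htail
  refine (htail.add hprod).congr' ?_ EventuallyEq.rfl
  filter_upwards [Metric.ball_mem_nhds (0 : ℂ) one_pos] with q hq
  have hmul : Multipliable fun n : ℕ => 1 - q ^ (n + K + 1) := by
    simpa only [sub_eq_add_neg] using
      multipliable_one_add_of_summable (hasSum_norm_pow_tail K (by simpa using hq)).summable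
  rw [euler, ← hmul.prod_mul_tprod_nat_mul' (f := fun n : ℕ => 1 - q ^ (n + 1))]
  ring

/-- The series of `euler ^ r`, truncated to `K` coefficients. -/
def eulerPow (K : ℕ) (r : ℤ) : List ℤ :=
  truncPow K (if 0 ≤ r then eulerSeries K K else truncInv (eulerSeries K K) K) r.natAbs

lemma approx_euler_zpow (K : ℕ) (r : ℤ) : Approx K (fun q => euler q ^ r) (eulerPow K r) := by
  rw [eulerPow]
  rcases le_or_gt 0 r with hr | hr
  · rw [if_pos hr]
    lift r to ℕ using hr
    simpa using (approx_euler K).pow r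
  · rw [if_neg hr.not_ge]
    simpa only [← zpow_natCast, Int.ofNat_natAbs_of_nonpos hr.le, inv_zpow', neg_neg]
      using ((approx_euler K).inv one_sub_euler_isBigO).pow r.natAbs

/-- The `q`-series `∏ᵢ euler (q ^ aᵢ) ^ dᵢ` of an eta quotient, without its leading power of `q`. -/
noncomputable def eulerQuotient (l : List (ℕ × ℤ)) (q : ℂ) : ℂ :=
  (l.map fun p => euler (q ^ p.1) ^ p.2).prod

/-- The series of `eulerQuotient l`, truncated to `K` coefficients. -/
def quotientSeries (K : ℕ) : List (ℕ × ℤ) → List ℤ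
  | [] => [1]
  | p :: l => (mul ((expand p.1 (eulerPow K p.2)).take K) (quotientSeries K l)).take K

lemma approx_eulerQuotient (K : ℕ) {l : List (ℕ × ℤ)} (hl : ∀ p ∈ l, 0 < p.1) :
    Approx K (eulerQuotient l) (quotientSeries K l) := by
  induction l with
  | nil => exact Approx.one
  | cons p l ih =>
    rw [List.forall_mem_cons] at hl
    exact ((approx_euler_zpow K p.2).comp_pow hl.1).take.mul (ih hl.2)

lemma etaQuotient_eq_exp_zpow_mul (l : List (ℕ × ℤ)) (τ : ℍ) :
    etaQuotient l τ =
      Complex.exp (2 * Real.pi * Complex.I * τ / 24) ^ order l * eulerQuotient l (nome τ) := by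
  induction l with
  | nil => simp [etaQuotient_nil, order, eulerQuotient]
  | cons p l ih =>
    rw [etaQuotient_cons, ih, eta_natCast_mul, order_cons, zpow_add₀ (Complex.exp_ne_zero _),
      zpow_mul, zpow_natCast, mul_zpow]
    simp only [eulerQuotient, List.map_cons, List.prod_cons]
    ring

lemma etaQuotient_mul_nome_pow {l : List (ℕ × ℤ)} {n M : ℕ} (h : order l + 24 * M = 24 * n)
    (τ : ℍ) : etaQuotient l τ * nome τ ^ M = nome τ ^ n * eulerQuotient l (nome τ) := by
  have hnome : nome τ = Complex.exp (2 * Real.pi * Complex.I * τ / 24) ^ (24 : ℤ) := by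
    rw [nome, ← Complex.exp_int_mul]
    push_cast
    ring_nf
  have hne : Complex.exp (2 * Real.pi * Complex.I * τ / 24) ≠ 0 := Complex.exp_ne_zero _
  rw [etaQuotient_eq_exp_zpow_mul, mul_right_comm]
  congr 1
  rw [hnome, ← zpow_natCast, ← zpow_natCast, ← zpow_mul, ← zpow_mul, ← zpow_add₀ hne, h]

/-- A linear combination of eta quotients. -/
noncomputable def comb (T : List (ℤ × List (ℕ × ℤ))) (τ : ℍ) : ℂ :=
  (T.map fun t => (t.1 : ℂ) * etaQuotient t.2 τ).sum

lemma comb_nil (τ : ℍ) : comb [] τ = 0 := rfl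

lemma comb_cons (t : ℤ × List (ℕ × ℤ)) (T : List (ℤ × List (ℕ × ℤ))) (τ : ℍ) :
    comb (t :: T) τ = t.1 * etaQuotient t.2 τ + comb T τ := rfl

/-- The exponent of the leading power of `q` in `q ^ M * etaQuotient l`; a junk value unless
it is a natural number. -/
def leadingExponent (M : ℕ) (l : List (ℕ × ℤ)) : ℕ := ((order l + 24 * M) / 24).toNat

/-- The series of `q ^ M * comb T`, where each eta quotient is truncated to `K` coefficients. -/
def combSeries (K M : ℕ) : List (ℤ × List (ℕ × ℤ)) → List ℤ
  | [] => []
  | t :: T =>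
    add ((List.replicate (leadingExponent M t.2) 0 ++ quotientSeries K t.2).map (t.1 * ·))
      (combSeries K M T)

lemma exists_approx_comb (K : ℕ) {M : ℕ} {T : List (ℤ × List (ℕ × ℤ))}
    (hpos : ∀ t ∈ T, ∀ p ∈ t.2, 0 < p.1)
    (hlead : ∀ t ∈ T, order t.2 + 24 * M = 24 * leadingExponent M t.2) :
    ∃ f : ℂ → ℂ, Approx K f (combSeries K M T) ∧ ∀ τ : ℍ, comb T τ * nome τ ^ M = f (nome τ) := by
  induction T with
  | nil =>
    exact ⟨fun _ => 0, .of_eq fun q => by rw [combSeries, eval_nil], fun τ => by simp [comb_nil]⟩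
  | cons t T ih =>
    rw [List.forall_mem_cons] at hpos hlead
    obtain ⟨f, hf, hfT⟩ := ih hpos.2 hlead.2
    refine ⟨_, (((approx_eulerQuotient K hpos.1).shift (leadingExponent M t.2)).const_mul t.1).add
      hf, fun τ => ?_⟩
    rw [← hfT τ, ← etaQuotient_mul_nome_pow hlead.1 τ, comb_cons]
    ring

lemma isZeroAtImInfty_comb {M : ℕ} {T : List (ℤ × List (ℕ × ℤ))}
    (hpos : ∀ t ∈ T, ∀ p ∈ t.2, 0 < p.1)
    (hlead : ∀ t ∈ T, order t.2 + 24 * M = 24 * leadingExponent M t.2)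
    (hzero : ∀ a ∈ (combSeries (M + 1) M T).take (M + 1), a = 0) : IsZeroAtImInfty (comb T) := by
  obtain ⟨f, hf, hfT⟩ := exists_approx_comb (M + 1) hpos hlead
  have hf_isBigO : f =O[𝓝 0] fun q => q ^ (M + 1) := by
    refine IsBigO.congr_left hf.take fun q => ?_
    rw [eval_eq_zero hzero, sub_zero]
  have h := (isBigO_refl (fun τ : ℍ => (nome τ ^ M)⁻¹) atImInfty).mul
    (hf_isBigO.comp_tendsto tendsto_nome)
  have hnome (τ : ℍ) : nome τ ≠ 0 := Complex.exp_ne_zero _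
  refine ((h.congr_left fun τ => ?_).congr_right fun τ => ?_).trans_tendsto tendsto_nome
  · rw [Function.comp_apply, ← hfT, mul_comm, mul_inv_cancel_right₀ (pow_ne_zero M (hnome τ))]
  · rw [Function.comp_apply, pow_succ, inv_mul_cancel_left₀ (pow_ne_zero M (hnome τ))]

/-! ### Vanishing criteria -/

lemma mdifferentiable_comb {T : List (ℤ × List (ℕ × ℤ))} (hpos : ∀ t ∈ T, ∀ p ∈ t.2, 0 < p.1) :
    MDiff (comb T) := by
  induction T with
  | nil => exact mdifferentiable_const
  | cons t T ih =>
    rw [List.forall_mem_cons] at hpos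
    exact (mdifferentiable_const.mul (mdifferentiable_etaQuotient hpos.1)).add (ih hpos.2)

lemma cuspOrder_emod {N : ℕ} {l : List (ℕ × ℤ)} (hdvd : ∀ p ∈ l, p.1 ∣ N) (c : ℤ) :
    cuspOrder N l (c % N) = cuspOrder N l c := by
  unfold cuspOrder
  congr 1
  refine List.map_congr_left fun p hp => ?_
  obtain ⟨k, hk⟩ := hdvd p hp
  have hgcd : (c % N).gcd p.1 = c.gcd p.1 := by
    rw [Int.emod_def, hk, Nat.cast_mul, mul_assoc, mul_comm, Int.gcd_sub_mul_right_left]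
  rw [hgcd]

/-- Ligozat's conditions for `etaQuotient l` to be a modular function for `Γ₀(N)`, restricted to
even exponents, together with holomorphy at the cusps other than infinity. -/
structure Admissible (N : ℕ) (l : List (ℕ × ℤ)) : Prop where
  dvd_level : ∀ p ∈ l, p.1 ∣ N
  even : ∀ p ∈ l, Even p.2
  weight_eq_zero : weight l = 0
  dvd_order : 24 ∣ order l
  dvd_coorder : 24 ∣ coorder N l
  cuspOrder_nonneg : ∀ c < N, 0 < c → 0 ≤ cuspOrder N l c

instance (N : ℕ) (l : List (ℕ × ℤ)) : Decidable (Admissible N l) :=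
  decidable_of_iff ((∀ p ∈ l, p.1 ∣ N) ∧ (∀ p ∈ l, Even p.2) ∧ weight l = 0 ∧ 24 ∣ order l ∧
      24 ∣ coorder N l ∧ ∀ c < N, 0 < c → 0 ≤ cuspOrder N l c)
    ⟨fun ⟨h₁, h₂, h₃, h₄, h₅, h₆⟩ => ⟨h₁, h₂, h₃, h₄, h₅, h₆⟩,
      fun ⟨h₁, h₂, h₃, h₄, h₅, h₆⟩ => ⟨h₁, h₂, h₃, h₄, h₅, h₆⟩⟩

lemma Admissible.smul {N : ℕ} (hN : 0 < N) {l : List (ℕ × ℤ)} (hl : Admissible N l)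
    {γ : SL(2, ℤ)} (hγ : (N : ℤ) ∣ γ 1 0) (τ : ℍ) : etaQuotient l (γ • τ) = etaQuotient l τ :=
  etaQuotient_smul_of_dvd hN hl.dvd_level hl.even hl.weight_eq_zero hl.dvd_order hl.dvd_coorder
    hγ τ

lemma Admissible.isBoundedAtImInfty_smul {N : ℕ} (hN : 0 < N) {l : List (ℕ × ℤ)}
    (hl : Admissible N l) {γ : SL(2, ℤ)} (hγ : ¬(N : ℤ) ∣ γ 1 0) :
    IsBoundedAtImInfty fun τ => etaQuotient l (γ • τ) := by
  refine isBoundedAtImInfty_etaQuotient_smul hN hl.dvd_level hl.even hl.weight_eq_zero ?_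
  have hN' : (0 : ℤ) < N := by exact_mod_cast hN
  obtain ⟨c, hc⟩ := Int.eq_ofNat_of_zero_le (Int.emod_nonneg (γ 1 0) hN'.ne')
  have hc_lt := Int.emod_lt_of_pos (γ 1 0) hN'
  have hc_ne : γ 1 0 % N ≠ 0 := fun h => hγ (Int.dvd_of_emod_eq_zero h)
  rw [← cuspOrder_emod hl.dvd_level, hc]
  exact hl.cuspOrder_nonneg c (by lia) (by lia)

lemma comb_smul {N : ℕ} (hN : 0 < N) {T : List (ℤ × List (ℕ × ℤ))}
    (hT : ∀ t ∈ T, Admissible N t.2) {γ : SL(2, ℤ)} (hγ : (N : ℤ) ∣ γ 1 0) (τ : ℍ) :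
    comb T (γ • τ) = comb T τ := by
  unfold comb
  congr 1
  exact List.map_congr_left fun t ht => by rw [(hT t ht).smul hN hγ]

lemma isBoundedAtImInfty_comb_smul {N : ℕ} (hN : 0 < N) {T : List (ℤ × List (ℕ × ℤ))}
    (hT : ∀ t ∈ T, Admissible N t.2) {γ : SL(2, ℤ)} (hγ : ¬(N : ℤ) ∣ γ 1 0) :
    IsBoundedAtImInfty fun τ => comb T (γ • τ) := by
  induction T with
  | nil => exact isBigO_zero _ _
  | cons t T ih =>
    rw [List.forall_mem_cons] at hT
    exact ((hT.1.isBoundedAtImInfty_smul hN hγ).const_mul_left _).add (ih hT.2)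

/-- The numerical criterion of `isZeroAtImInfty_comb` for `comb T` to vanish at infinity: every
term has at most a pole of order `M`, and the `q`-expansion of `q ^ M * comb T` vanishes through
`q ^ M`. -/
structure VanishesAtInfty (M : ℕ) (T : List (ℤ × List (ℕ × ℤ))) : Prop where
  pos : ∀ t ∈ T, ∀ p ∈ t.2, 0 < p.1
  order_eq : ∀ t ∈ T, order t.2 + 24 * M = 24 * leadingExponent M t.2
  coeff_eq_zero : ∀ a ∈ (combSeries (M + 1) M T).take (M + 1), a = 0

instance (M : ℕ) (T : List (ℤ × List (ℕ × ℤ))) : Decidable (VanishesAtInfty M T) :=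
  decidable_of_iff ((∀ t ∈ T, ∀ p ∈ t.2, 0 < p.1) ∧
      (∀ t ∈ T, order t.2 + 24 * M = 24 * leadingExponent M t.2) ∧
      ∀ a ∈ (combSeries (M + 1) M T).take (M + 1), a = 0)
    ⟨fun ⟨h₁, h₂, h₃⟩ => ⟨h₁, h₂, h₃⟩, fun ⟨h₁, h₂, h₃⟩ => ⟨h₁, h₂, h₃⟩⟩

lemma VanishesAtInfty.isZeroAtImInfty {M : ℕ} {T : List (ℤ × List (ℕ × ℤ))}
    (h : VanishesAtInfty M T) : IsZeroAtImInfty (comb T) :=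
  isZeroAtImInfty_comb h.pos h.order_eq h.coeff_eq_zero

theorem comb_eq_zero_of_admissible {N M : ℕ} (hN : 0 < N) {T : List (ℤ × List (ℕ × ℤ))}
    (hT : ∀ t ∈ T, Admissible N t.2) (hinfty : VanishesAtInfty M T) (τ : ℍ) : comb T τ = 0 := by
  have : NeZero N := ⟨hN.ne'⟩
  have hzero := hinfty.isZeroAtImInfty
  have hslash (γ : SL(2, ℤ)) : comb T ∣[(0 : ℤ)] γ = fun τ => comb T (γ • τ) := by
    ext τ
    simp [SL_slash_apply]
  let F : ModularForm (CongruenceSubgroup.Gamma0 N : Subgroup (GL (Fin 2) ℝ)) 0 :=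
    { toFun := comb T
      slash_action_eq' := by
        rintro _ ⟨γ, hγ, rfl⟩
        refine (hslash γ).trans (funext fun τ => comb_smul hN hT ?_ τ)
        exact (ZMod.intCast_zmod_eq_zero_iff_dvd _ _).mp (CongruenceSubgroup.Gamma0_mem.mp hγ)
      holo' := mdifferentiable_comb hinfty.pos
      bdd_at_cusps' := by
        intro c hc
        rw [Subgroup.IsArithmetic.isCusp_iff_isCusp_SL2Z] at hc
        rw [OnePoint.isBoundedAt_iff_forall_SL2Z hc]
        intro γ _
        rw [hslash]
        by_cases hγ : (N : ℤ) ∣ γ 1 0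
        · simp only [comb_smul hN hT hγ]
          exact hzero.isBoundedAtImInfty
        · exact isBoundedAtImInfty_comb_smul hN hT hγ }
  obtain ⟨c, hc⟩ := ModularForm.eq_const_of_weight_zero F
  have hconst : comb T = Function.const ℍ c := hc
  have hlim : Tendsto (comb T) atImInfty (𝓝 0) := hzero
  rw [hconst] at hlim ⊢
  exact tendsto_nhds_unique tendsto_const_nhds hlim

/-- The terms of the product of `comb T` and `etaQuotient g`. -/
def mulTerms (g : List (ℕ × ℤ)) (T : List (ℤ × List (ℕ × ℤ))) : List (ℤ × List (ℕ × ℤ)) :=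
  T.map fun t => (t.1, t.2 ++ g)

lemma comb_mulTerms (g : List (ℕ × ℤ)) (T : List (ℤ × List (ℕ × ℤ))) (τ : ℍ) :
    comb (mulTerms g T) τ = comb T τ * etaQuotient g τ := by
  simp only [comb, mulTerms, List.map_map, Function.comp_def, etaQuotient_append, ← mul_assoc,
    List.sum_map_mul_right]

/-- Multiplying by `etaQuotient g` moves all the poles of `comb T` at the cusps of `Γ₀(N)` to
infinity, where a finite computation then rules them out. -/
theorem comb_eq_zero (N M : ℕ) (g : List (ℕ × ℤ)) {T : List (ℤ × List (ℕ × ℤ))}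
    (h : 0 < N ∧ (∀ p ∈ g, 0 < p.1) ∧ (∀ t ∈ mulTerms g T, Admissible N t.2) ∧
      VanishesAtInfty M (mulTerms g T)) (τ : ℍ) : comb T τ = 0 := by
  obtain ⟨hN, hg, hT, hinfty⟩ := h
  have hzero := comb_eq_zero_of_admissible hN hT hinfty τ
  rw [comb_mulTerms] at hzero
  exact (mul_eq_zero.mp hzero).resolve_right (etaQuotient_ne_zero hg τ)

/-- The second factor does not vanish identically, since its product with `etaQuotient w` tends to
`c` at infinity. -/
theorem comb_eq_zero_of_mul_eq_zero (M : ℕ) (w : List (ℕ × ℤ)) (c : ℤ)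
    {T₁ T₂ : List (ℤ × List (ℕ × ℤ))}
    (h : c ≠ 0 ∧ (∀ t ∈ T₁, ∀ p ∈ t.2, 0 < p.1) ∧ (∀ t ∈ T₂, ∀ p ∈ t.2, 0 < p.1) ∧
      VanishesAtInfty M ((-c, []) :: mulTerms w T₂))
    (hmul : ∀ τ, comb T₁ τ * comb T₂ τ = 0) (τ : ℍ) : comb T₁ τ = 0 := by
  obtain ⟨hc, hT₁, hT₂, hinfty⟩ := h
  rcases (mul_eq_zero_iff (mdifferentiable_comb hT₁) (mdifferentiable_comb hT₂)).mp (funext hmul)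
    with hzero | hzero
  · exact congrFun hzero τ
  have hconst : comb ((-c, []) :: mulTerms w T₂) = fun _ => -(c : ℂ) := by
    ext τ
    simp [comb_cons, comb_mulTerms, hzero, etaQuotient_nil]
  have hlim : Tendsto (comb ((-c, []) :: mulTerms w T₂)) atImInfty (𝓝 0) := hinfty.isZeroAtImInfty
  rw [hconst] at hlim
  have hc_zero := tendsto_nhds_unique hlim tendsto_const_nhds
  rw [eq_comm, neg_eq_zero, Int.cast_eq_zero] at hc_zero
  exact absurd hc_zero hc

/-! ### Polynomial relations between two eta quotients -/

/-- The value at `(z, y)` of the Laurent polynomial whose terms `c * z ^ i * y ^ j` are encoded as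
`(c, i, j)`. -/
noncomputable def laurent (R : List (ℤ × ℤ × ℤ)) (z y : ℂ) : ℂ :=
  (R.map fun r => (r.1 : ℂ) * (z ^ r.2.1 * y ^ r.2.2)).sum

lemma laurent_nil (z y : ℂ) : laurent [] z y = 0 := rfl

lemma laurent_cons (r : ℤ × ℤ × ℤ) (R : List (ℤ × ℤ × ℤ)) (z y : ℂ) :
    laurent (r :: R) z y = r.1 * (z ^ r.2.1 * y ^ r.2.2) + laurent R z y := rfl

lemma laurent_append (R S : List (ℤ × ℤ × ℤ)) (z y : ℂ) :
    laurent (R ++ S) z y = laurent R z y + laurent S z y := by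
  simp only [laurent, List.map_append, List.sum_append]

/-- The product of two Laurent polynomials, without collecting like terms. -/
def mulLaurent (R S : List (ℤ × ℤ × ℤ)) : List (ℤ × ℤ × ℤ) :=
  R.flatMap fun r => S.map fun s => (r.1 * s.1, r.2.1 + s.2.1, r.2.2 + s.2.2)

lemma laurent_mulLaurent (R S : List (ℤ × ℤ × ℤ)) {z y : ℂ} (hz : z ≠ 0) (hy : y ≠ 0) :
    laurent (mulLaurent R S) z y = laurent R z y * laurent S z y := by
  induction R with
  | nil => simp [mulLaurent, laurent_nil]
  | cons r R ih =>
    rw [mulLaurent, List.flatMap_cons, laurent_append, ← mulLaurent, ih, laurent_cons, add_mul]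
    congr 1
    simp only [laurent, List.map_map, ← List.sum_map_mul_left]
    refine congrArg List.sum (List.map_congr_left fun s _ => ?_)
    simp only [Function.comp_apply, zpow_add₀ hz, zpow_add₀ hy]
    push_cast
    ring

/-- The negative of a Laurent polynomial. -/
def negLaurent (R : List (ℤ × ℤ × ℤ)) : List (ℤ × ℤ × ℤ) := R.map fun r => (-r.1, r.2)

lemma laurent_negLaurent (R : List (ℤ × ℤ × ℤ)) (z y : ℂ) :
    laurent (negLaurent R) z y = -laurent R z y := by
  induction R with
  | nil => simp [negLaurent, laurent_nil]
  | cons r R ih =>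
    rw [negLaurent, List.map_cons, laurent_cons, ← negLaurent, ih, laurent_cons]
    push_cast
    ring

/-- The terms of a Laurent polynomial in the eta quotients `z` and `y`. -/
def laurentTerms (z y : List (ℕ × ℤ)) (R : List (ℤ × ℤ × ℤ)) : List (ℤ × List (ℕ × ℤ)) :=
  R.map fun r => (r.1, scale r.2.1 z ++ scale r.2.2 y)

lemma comb_laurentTerms (z y : List (ℕ × ℤ)) (R : List (ℤ × ℤ × ℤ)) (τ : ℍ) :
    comb (laurentTerms z y R) τ = laurent R (etaQuotient z τ) (etaQuotient y τ) := by
  simp only [comb, laurentTerms, laurent, List.map_map, Function.comp_def, etaQuotient_append,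
    etaQuotient_scale]

/-- A certificate that the Laurent polynomial `R` vanishes at the eta quotients `z` and `y` of
level `N`: see `comb_eq_zero`. -/
def Certificate (N M : ℕ) (g z y : List (ℕ × ℤ)) (R : List (ℤ × ℤ × ℤ)) : Prop :=
  0 < N ∧ (∀ p ∈ g, 0 < p.1) ∧ (∀ t ∈ mulTerms g (laurentTerms z y R), Admissible N t.2) ∧
    VanishesAtInfty M (mulTerms g (laurentTerms z y R))

instance (N M : ℕ) (g z y : List (ℕ × ℤ)) (R : List (ℤ × ℤ × ℤ)) :
    Decidable (Certificate N M g z y R) := by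
  unfold Certificate
  infer_instance

theorem laurent_eq_zero (N M : ℕ) (g : List (ℕ × ℤ)) (R : List (ℤ × ℤ × ℤ))
    {lz ly : List (ℕ × ℤ)} (h : Certificate N M g lz ly R) {τ : ℍ} {z y : ℂ}
    (hz : z = etaQuotient lz τ) (hy : y = etaQuotient ly τ) : laurent R z y = 0 := by
  rw [hz, hy, ← comb_laurentTerms]
  exact comb_eq_zero N M g h τ

/-- A certificate that the Laurent polynomials `R` and `S` have equal squares at the eta quotients
`z` and `y` of level `N`, while the leading coefficient `c` of their sum is not `0`: see
`comb_eq_zero_of_mul_eq_zero`. -/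
def SqCertificate (N M : ℕ) (g : List (ℕ × ℤ)) (M' : ℕ) (w : List (ℕ × ℤ)) (c : ℤ)
    (z y : List (ℕ × ℤ)) (R S : List (ℤ × ℤ × ℤ)) : Prop :=
  (∀ p ∈ z, 0 < p.1) ∧ (∀ p ∈ y, 0 < p.1) ∧
    Certificate N M g z y (mulLaurent R R ++ negLaurent (mulLaurent S S)) ∧
    c ≠ 0 ∧ VanishesAtInfty M' ((-c, []) :: mulTerms w (laurentTerms z y (R ++ S)))

instance (N M : ℕ) (g : List (ℕ × ℤ)) (M' : ℕ) (w : List (ℕ × ℤ)) (c : ℤ)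
    (z y : List (ℕ × ℤ)) (R S : List (ℤ × ℤ × ℤ)) :
    Decidable (SqCertificate N M g M' w c z y R S) := by
  unfold SqCertificate
  infer_instance

lemma pos_of_mem_laurentTerms {z y : List (ℕ × ℤ)} (hz : ∀ p ∈ z, 0 < p.1)
    (hy : ∀ p ∈ y, 0 < p.1) (R : List (ℤ × ℤ × ℤ)) :
    ∀ t ∈ laurentTerms z y R, ∀ p ∈ t.2, 0 < p.1 := by
  simp only [laurentTerms, scale, List.forall_mem_map, List.forall_mem_append]
  exact fun _ _ => ⟨hz, hy⟩

/-- Equal squares are within reach even when the exponents in `R` and `S` themselves are odd. -/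
theorem laurent_eq_laurent (N M : ℕ) (g : List (ℕ × ℤ)) (M' : ℕ) (w : List (ℕ × ℤ)) (c : ℤ)
    (R S : List (ℤ × ℤ × ℤ)) {lz ly : List (ℕ × ℤ)} (h : SqCertificate N M g M' w c lz ly R S)
    {τ : ℍ} {z y : ℂ} (hz : z = etaQuotient lz τ) (hy : y = etaQuotient ly τ) :
    laurent R z y = laurent S z y := by
  obtain ⟨hpos_z, hpos_y, hsq, hc, hinfty⟩ := h
  have hpos := pos_of_mem_laurentTerms hpos_z hpos_y
  have hmul (τ : ℍ) : comb (laurentTerms lz ly (R ++ negLaurent S)) τ *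
      comb (laurentTerms lz ly (R ++ S)) τ = 0 := by
    have hsq_eq := laurent_eq_zero N M g _ hsq (τ := τ) rfl rfl
    rw [laurent_append, laurent_negLaurent] at hsq_eq
    rw [laurent_mulLaurent R R (etaQuotient_ne_zero hpos_z τ) (etaQuotient_ne_zero hpos_y τ),
      laurent_mulLaurent S S (etaQuotient_ne_zero hpos_z τ) (etaQuotient_ne_zero hpos_y τ)]
      at hsq_eq
    simp only [comb_laurentTerms, laurent_append, laurent_negLaurent]
    linear_combination hsq_eq
  have hsub := comb_eq_zero_of_mul_eq_zero M' w c ⟨hc, hpos _, hpos _, hinfty⟩ hmul τ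
  rw [comb_laurentTerms, laurent_append, laurent_negLaurent, ← hz, ← hy] at hsub
  exact eq_of_sub_eq_zero (by rw [sub_eq_add_neg, hsub])

theorem relation_level_four {τ : ℍ} {z y : ℂ}
    (hz : z = etaQuotient [(1, 4), (4, -4)] τ)
    (hy : y = etaQuotient [(2, 24), (1, -12), (4, -12)] τ) :
    z + 16 * z⁻¹ = y := by
  have hz_ne : z ≠ 0 := hz ▸ etaQuotient_ne_zero (by decide) τ
  have h := laurent_eq_zero (N := 4) (M := 1) (g := [(1, 4), (4, -4)])
    (R := [(1, 1, 0), (-1, 0, 1), (16, -1, 0)]) (by decide +kernel) hz hy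
  simp only [laurent_cons, laurent_nil] at h
  linear_combination (norm := (push_cast; field_simp; ring)) h

theorem relation_level_six_one_three {τ : ℍ} {z y : ℂ}
    (hz : z = etaQuotient [(1, 12), (3, -12)] τ)
    (hy : y = etaQuotient [(1, 6), (3, 6), (2, -6), (6, -6)] τ) :
    z + 729 * z⁻¹ + 54 = (y + 16) ^ 3 * (y ^ 2)⁻¹ := by
  have hz_ne : z ≠ 0 := hz ▸ etaQuotient_ne_zero (by decide) τ
  have hy_ne : y ≠ 0 := hy ▸ etaQuotient_ne_zero (by decide) τ
  have h := laurent_eq_zero (N := 6) (M := 6) (g := [(2, 12), (3, 24), (6, -36)])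
    (R := [(1, 1, 0), (-1, 0, 1), (6, 0, 0), (-768, 0, -1), (-4096, 0, -2), (729, -1, 0)])
    (by decide +kernel) hz hy
  simp only [laurent_cons, laurent_nil] at h
  linear_combination (norm := (push_cast; field_simp; ring)) h

theorem relation_level_six_two_six {τ : ℍ} {z y : ℂ}
    (hz : z = etaQuotient [(2, 12), (6, -12)] τ)
    (hy : y = etaQuotient [(1, 6), (3, 6), (2, -6), (6, -6)] τ) :
    z + 729 * z⁻¹ + 54 = (y + 4) ^ 3 * y⁻¹ := by
  have hz_ne : z ≠ 0 := hz ▸ etaQuotient_ne_zero (by decide) τ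
  have hy_ne : y ≠ 0 := hy ▸ etaQuotient_ne_zero (by decide) τ
  have h := laurent_eq_zero (N := 6) (M := 6) (g := [(1, -6), (2, 18), (3, 18), (6, -30)])
    (R := [(1, 1, 0), (-1, 0, 2), (-12, 0, 1), (6, 0, 0), (-64, 0, -1), (729, -1, 0)])
    (by decide +kernel) hz hy
  simp only [laurent_cons, laurent_nil] at h
  linear_combination (norm := (push_cast; field_simp; ring)) h

theorem relation_level_six_one_two {τ : ℍ} {z y : ℂ}
    (hz : z = etaQuotient [(1, 12), (2, -12)] τ)
    (hy : y = etaQuotient [(1, 2), (2, 2), (3, -2), (6, -2)] τ) :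
    z + 64 * z⁻¹ = (y ^ 2 + 27) ^ 2 * (y ^ 3)⁻¹ := by
  have hz_ne : z ≠ 0 := hz ▸ etaQuotient_ne_zero (by decide) τ
  have hy_ne : y ≠ 0 := hy ▸ etaQuotient_ne_zero (by decide) τ
  have h := laurent_eq_zero (N := 6) (M := 4) (g := [(2, 12), (3, 12), (6, -24)])
    (R := [(1, 1, 0), (-1, 0, 1), (-54, 0, -1), (-729, 0, -3), (64, -1, 0)])
    (by decide +kernel) hz hy
  simp only [laurent_cons, laurent_nil] at h
  linear_combination (norm := (push_cast; field_simp; ring)) h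

theorem relation_level_six_three_six {τ : ℍ} {z y : ℂ}
    (hz : z = etaQuotient [(3, 12), (6, -12)] τ)
    (hy : y = etaQuotient [(1, 2), (2, 2), (3, -2), (6, -2)] τ) :
    z + 64 * z⁻¹ = (y ^ 2 + 3) ^ 2 * y⁻¹ := by
  have hz_ne : z ≠ 0 := hz ▸ etaQuotient_ne_zero (by decide) τ
  have hy_ne : y ≠ 0 := hy ▸ etaQuotient_ne_zero (by decide) τ
  have h := laurent_eq_zero (N := 6) (M := 4) (g := [(1, -4), (2, 8), (3, 16), (6, -20)])
    (R := [(1, 1, 0), (-1, 0, 3), (-6, 0, 1), (-9, 0, -1), (64, -1, 0)]) (by decide +kernel) hz hy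
  simp only [laurent_cons, laurent_nil] at h
  linear_combination (norm := (push_cast; field_simp; ring)) h

theorem relation_level_eight_add_four (τ : ℍ) :
    etaQuotient [(1, 4), (4, 2), (2, -2), (8, -4)] τ + 4 =
      etaQuotient [(2, -4), (4, 12), (8, -8)] τ := by
  have h := laurent_eq_zero (N := 8) (M := 1) (g := []) (R := [(-1, 1, 0), (1, 0, 1), (4, 0, 0)])
    (by decide +kernel) (τ := τ) (lz := [(2, -4), (4, 12), (8, -8)])
    (ly := [(1, 4), (4, 2), (2, -2), (8, -4)]) rfl rfl
  simp only [laurent_cons, laurent_nil] at h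
  linear_combination (norm := (push_cast; simp only [zpow_zero, zpow_one]; ring)) h

theorem relation_level_eight_add_eight (τ : ℍ) :
    etaQuotient [(1, 4), (4, 2), (2, -2), (8, -4)] τ + 8 =
      etaQuotient [(1, -4), (2, 10), (4, -2), (8, -4)] τ := by
  have h := laurent_eq_zero (N := 8) (M := 1) (g := []) (R := [(-1, 1, 0), (1, 0, 1), (8, 0, 0)])
    (by decide +kernel) (τ := τ) (lz := [(1, -4), (2, 10), (4, -2), (8, -4)])
    (ly := [(1, 4), (4, 2), (2, -2), (8, -4)]) rfl rfl
  simp only [laurent_cons, laurent_nil] at h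
  linear_combination (norm := (push_cast; simp only [zpow_zero, zpow_one]; ring)) h

theorem relation_level_eight {τ : ℍ} {z₁ z₂ y : ℂ}
    (hz₁ : z₁ = etaQuotient [(1, 24), (2, -24)] τ)
    (hz₂ : z₂ = etaQuotient [(2, 12), (4, -12)] τ)
    (hy : y = etaQuotient [(1, 4), (4, 2), (2, -2), (8, -4)] τ) :
    z₁ = y ^ 4 / ((y + 4) * (y + 8) ^ 2) ∧ z₂ = y * (y + 8) / (y + 4) := by
  rw [hz₁, hz₂, hy, relation_level_eight_add_four, relation_level_eight_add_eight]
  have hne {δ : ℕ} (hδ : 0 < δ) : eta (τ * δ) ≠ 0 := mul_comm (δ : ℂ) τ ▸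
    eta_natCast_mul_ne_zero hδ τ
  have h₁ := hne (δ := 1) (by decide)
  have h₂ := hne (δ := 2) (by decide)
  have h₄ := hne (δ := 4) (by decide)
  have h₈ := hne (δ := 8) (by decide)
  simp only [etaQuotient_cons, etaQuotient_nil]
  constructor <;> field_simp

theorem level_eight_add_four_ne_zero (τ : ℍ) :
    etaQuotient [(1, 4), (4, 2), (2, -2), (8, -4)] τ + 4 ≠ 0 :=
  relation_level_eight_add_four τ ▸ etaQuotient_ne_zero (by decide) τ

theorem level_eight_add_eight_ne_zero (τ : ℍ) :
    etaQuotient [(1, 4), (4, 2), (2, -2), (8, -4)] τ + 8 ≠ 0 :=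
  relation_level_eight_add_eight τ ▸ etaQuotient_ne_zero (by decide) τ

theorem relation_level_nine {τ : ℍ} {z y : ℂ}
    (hz : z = etaQuotient [(1, 3), (9, -3)] τ)
    (hy : y = etaQuotient [(3, 12), (1, -6), (9, -6)] τ) :
    z + 9 + 27 * z⁻¹ = y := by
  have hz_ne : z ≠ 0 := hz ▸ etaQuotient_ne_zero (by decide) τ
  have h := laurent_eq_laurent (N := 9) (M := 4) (g := [(1, 6), (9, -6)]) (M' := 0)
    (w := [(1, -3), (9, 3)]) (c := 2) (R := [(1, 1, 0), (27, -1, 0)]) (S := [(1, 0, 1), (-9, 0, 0)])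
    (by decide +kernel) hz hy
  simp only [laurent_cons, laurent_nil] at h
  linear_combination (norm := (push_cast; field_simp; ring)) h

theorem relation_level_ten_one_five {τ : ℍ} {z y : ℂ}
    (hz : z = etaQuotient [(1, 6), (5, -6)] τ)
    (hy : y = etaQuotient [(1, 4), (5, 4), (2, -4), (10, -4)] τ) :
    z + 125 * z⁻¹ + 22 = (y + 4) * (1 + 8 * y⁻¹) ^ 2 := by
  have hz_ne : z ≠ 0 := hz ▸ etaQuotient_ne_zero (by decide) τ
  have hy_ne : y ≠ 0 := hy ▸ etaQuotient_ne_zero (by decide) τ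
  have h := laurent_eq_zero (N := 10) (M := 6) (g := [(1, 2), (2, 4), (5, 14), (10, -20)])
    (R := [(1, 1, 0), (-1, 0, 1), (2, 0, 0), (-128, 0, -1), (-256, 0, -2), (125, -1, 0)])
    (by decide +kernel) hz hy
  simp only [laurent_cons, laurent_nil] at h
  linear_combination (norm := (push_cast; field_simp; ring)) h

theorem relation_level_ten_two_ten {τ : ℍ} {z y : ℂ}
    (hz : z = etaQuotient [(2, 6), (10, -6)] τ)
    (hy : y = etaQuotient [(1, 4), (5, 4), (2, -4), (10, -4)] τ) :
    z + 125 * z⁻¹ + 22 = (y + 2) ^ 2 * (1 + 4 * y⁻¹) := by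
  have hz_ne : z ≠ 0 := hz ▸ etaQuotient_ne_zero (by decide) τ
  have hy_ne : y ≠ 0 := hy ▸ etaQuotient_ne_zero (by decide) τ
  have h := laurent_eq_zero (N := 10) (M := 6) (g := [(1, -2), (2, 8), (5, 10), (10, -16)])
    (R := [(1, 1, 0), (-1, 0, 2), (-8, 0, 1), (2, 0, 0), (-16, 0, -1), (125, -1, 0)])
    (by decide +kernel) hz hy
  simp only [laurent_cons, laurent_nil] at h
  linear_combination (norm := (push_cast; field_simp; ring)) h

theorem relation_level_twelve_add_four (τ : ℍ) :
    etaQuotient [(1, 2), (3, 2), (4, -2), (12, -2)] τ + 4 =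
      etaQuotient [(1, -2), (2, 6), (3, -2), (4, -4), (6, 6), (12, -4)] τ := by
  have h := laurent_eq_zero (N := 12) (M := 2) (g := [(2, -2), (4, 4), (6, 2), (12, -4)])
    (R := [(-1, 1, 0), (1, 0, 1), (4, 0, 0)]) (by decide +kernel) (τ := τ)
    (lz := [(1, -2), (2, 6), (3, -2), (4, -4), (6, 6), (12, -4)])
    (ly := [(1, 2), (3, 2), (4, -2), (12, -2)]) rfl rfl
  simp only [laurent_cons, laurent_nil] at h
  linear_combination (norm := (push_cast; simp only [zpow_zero, zpow_one]; ring)) h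

theorem level_twelve_add_four_ne_zero (τ : ℍ) :
    etaQuotient [(1, 2), (3, 2), (4, -2), (12, -2)] τ + 4 ≠ 0 :=
  relation_level_twelve_add_four τ ▸ etaQuotient_ne_zero (by decide) τ

theorem relation_level_twelve_one_three {τ : ℍ} {z y : ℂ}
    (hz : z = etaQuotient [(1, 12), (3, -12)] τ)
    (hy : y = etaQuotient [(1, 2), (3, 2), (4, -2), (12, -2)] τ) :
    z + 729 * z⁻¹ + 54 = (y + 8) ^ 6 / (y ^ 4 * (y + 4)) := by
  have hz_ne : z ≠ 0 := hz ▸ etaQuotient_ne_zero (by decide) τ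
  have hy_ne : y ≠ 0 := hy ▸ etaQuotient_ne_zero (by decide) τ
  have hy_add_four_ne : y + 4 ≠ 0 := hy ▸ level_twelve_add_four_ne_zero τ
  have h := laurent_eq_zero (N := 12) (M := 14)
    (g := [(1, 6), (2, -8), (3, 6), (4, 16), (6, 20), (12, -40)]) (R := [(1, 1, 1), (4, 1, 0),
    (-1, 0, 2), (6, 0, 1), (-744, 0, 0), (-10240, 0, -1), (-61440, 0, -2), (-196608, 0, -3),
    (-262144, 0, -4), (729, -1, 1), (2916, -1, 0)]) (by decide +kernel) hz hy
  simp only [laurent_cons, laurent_nil] at h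
  linear_combination (norm := (push_cast; field_simp; ring)) (y + 4)⁻¹ * h

theorem relation_level_twelve_two_six {τ : ℍ} {z y : ℂ}
    (hz : z = etaQuotient [(2, 6), (6, -6)] τ)
    (hy : y = etaQuotient [(1, 2), (3, 2), (4, -2), (12, -2)] τ) :
    z - 27 * z⁻¹ = (y + 2) * (y - 4) * (y + 8) / (y * (y + 4)) := by
  have hz_ne : z ≠ 0 := hz ▸ etaQuotient_ne_zero (by decide) τ
  have hy_ne : y ≠ 0 := hy ▸ etaQuotient_ne_zero (by decide) τ
  have hy_add_four_ne : y + 4 ≠ 0 := hy ▸ level_twelve_add_four_ne_zero τ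
  have h := laurent_eq_zero (N := 12) (M := 8) (g := [(2, -2), (4, 10), (6, 14), (12, -22)])
    (R := [(1, 1, 1), (4, 1, 0), (-1, 0, 2), (-6, 0, 1), (24, 0, 0), (64, 0, -1), (-27, -1, 1),
    (-108, -1, 0)]) (by decide +kernel) hz hy
  simp only [laurent_cons, laurent_nil] at h
  linear_combination (norm := (push_cast; field_simp; ring)) (y + 4)⁻¹ * h

theorem relation_level_twelve_four_twelve {τ : ℍ} {z y : ℂ}
    (hz : z = etaQuotient [(4, 12), (12, -12)] τ)
    (hy : y = etaQuotient [(1, 2), (3, 2), (4, -2), (12, -2)] τ) :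
    z + 729 * z⁻¹ + 54 = (y + 2) ^ 6 / (y * (y + 4)) := by
  have hz_ne : z ≠ 0 := hz ▸ etaQuotient_ne_zero (by decide) τ
  have hy_ne : y ≠ 0 := hy ▸ etaQuotient_ne_zero (by decide) τ
  have hy_add_four_ne : y + 4 ≠ 0 := hy ▸ level_twelve_add_four_ne_zero τ
  have h := laurent_eq_zero (N := 12) (M := 14) (g := [(2, -8), (4, 22), (6, 20), (12, -34)])
    (R := [(1, 1, 1), (4, 1, 0), (-1, 0, 5), (-12, 0, 4), (-60, 0, 3), (-160, 0, 2), (-186, 0, 1),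
    (24, 0, 0), (-64, 0, -1), (729, -1, 1), (2916, -1, 0)]) (by decide +kernel) hz hy
  simp only [laurent_cons, laurent_nil] at h
  linear_combination (norm := (push_cast; field_simp; ring)) (y + 4)⁻¹ * h

theorem relation_level_fourteen_one_seven {τ : ℍ} {z y : ℂ}
    (hz : z = etaQuotient [(1, 4), (7, -4)] τ)
    (hy : y = etaQuotient [(1, 3), (7, 3), (2, -3), (14, -3)] τ) :
    z + 49 * z⁻¹ + 13 = (y + 4) ^ 3 * (y ^ 2)⁻¹ := by
  have hz_ne : z ≠ 0 := hz ▸ etaQuotient_ne_zero (by decide) τ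
  have hy_ne : y ≠ 0 := hy ▸ etaQuotient_ne_zero (by decide) τ
  have h := laurent_eq_laurent (N := 14) (M := 12) (g := [(1, 4), (2, 4), (7, 20), (14, -28)])
    (M' := 0) (w := [(1, -3), (2, 3), (7, -3), (14, 3)]) (c := 2)
    (R := [(1, 1, 0), (1, 0, 0), (49, -1, 0), (-64, 0, -2)]) (S := [(1, 0, 1), (48, 0, -1)])
    (by decide +kernel) hz hy
  simp only [laurent_cons, laurent_nil] at h
  linear_combination (norm := (push_cast; field_simp; ring)) h

theorem relation_level_fourteen_two_fourteen {τ : ℍ} {z y : ℂ}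
    (hz : z = etaQuotient [(2, 4), (14, -4)] τ)
    (hy : y = etaQuotient [(1, 3), (7, 3), (2, -3), (14, -3)] τ) :
    z + 49 * z⁻¹ + 13 = (y + 2) ^ 3 * y⁻¹ := by
  have hz_ne : z ≠ 0 := hz ▸ etaQuotient_ne_zero (by decide) τ
  have hy_ne : y ≠ 0 := hy ▸ etaQuotient_ne_zero (by decide) τ
  have h := laurent_eq_laurent (N := 14) (M := 12) (g := [(1, -2), (2, 10), (7, 14), (14, -22)])
    (M' := 1) (w := [(1, -3), (2, 3), (7, -3), (14, 3)]) (c := 12)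
    (R := [(1, 1, 0), (1, 0, 0), (49, -1, 0), (-1, 0, 2)]) (S := [(6, 0, 1), (8, 0, -1)])
    (by decide +kernel) hz hy
  simp only [laurent_cons, laurent_nil] at h
  linear_combination (norm := (push_cast; field_simp; ring)) h

theorem relation_level_fifteen_one_five {τ : ℍ} {z y : ℂ}
    (hz : z = etaQuotient [(1, 6), (5, -6)] τ)
    (hy : y = etaQuotient [(1, 2), (5, 2), (3, -2), (15, -2)] τ) :
    z + 125 * z⁻¹ + 22 = (y + 9 + 27 * y⁻¹) ^ 2 * y⁻¹ := by
  have hz_ne : z ≠ 0 := hz ▸ etaQuotient_ne_zero (by decide) τ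
  have hy_ne : y ≠ 0 := hy ▸ etaQuotient_ne_zero (by decide) τ
  have h := laurent_eq_zero (N := 15) (M := 10) (g := [(1, 2), (3, 4), (5, 14), (15, -20)])
    (R := [(1, 1, 0), (-1, 0, 1), (4, 0, 0), (-135, 0, -1), (-486, 0, -2), (-729, 0, -3),
    (125, -1, 0)]) (by decide +kernel) hz hy
  simp only [laurent_cons, laurent_nil] at h
  linear_combination (norm := (push_cast; field_simp; ring)) h

theorem relation_level_fifteen_three_fifteen {τ : ℍ} {z y : ℂ}
    (hz : z = etaQuotient [(3, 6), (15, -6)] τ)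
    (hy : y = etaQuotient [(1, 2), (5, 2), (3, -2), (15, -2)] τ) :
    z + 125 * z⁻¹ + 22 = (y + 3 + 3 * y⁻¹) ^ 2 * y := by
  have hz_ne : z ≠ 0 := hz ▸ etaQuotient_ne_zero (by decide) τ
  have hy_ne : y ≠ 0 := hy ▸ etaQuotient_ne_zero (by decide) τ
  have h := laurent_eq_zero (N := 15) (M := 10) (g := [(1, -2), (3, 8), (5, 10), (15, -16)])
    (R := [(1, 1, 0), (-1, 0, 3), (-6, 0, 2), (-15, 0, 1), (4, 0, 0), (-9, 0, -1), (125, -1, 0)])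
    (by decide +kernel) hz hy
  simp only [laurent_cons, laurent_nil] at h
  linear_combination (norm := (push_cast; field_simp; ring)) h

end EtaQuotient

open EtaQuotient

theorem lemma5p2 (τ : ℍ) :
    -- level 4
    (let y := etaQuotient [(2, 24), (1, -12), (4, -12)] τ
     let z := etaQuotient [(1, 4), (4, -4)] τ
     z + 16 * z⁻¹ = y) ∧
    -- level 9
    (let y := etaQuotient [(3, 12), (1, -6), (9, -6)] τ
     let z := etaQuotient [(1, 3), (9, -3)] τ
     z + 9 + 27 * z⁻¹ = y) ∧
    -- level 8
    (let y := etaQuotient [(1, 4), (4, 2), (2, -2), (8, -4)] τ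
     let z₁ := etaQuotient [(1, 24), (2, -24)] τ
     let z₂ := etaQuotient [(2, 12), (4, -12)] τ
     y + 4 ≠ 0 ∧ y + 8 ≠ 0 ∧
     z₁ = y ^ 4 / ((y + 4) * (y + 8) ^ 2) ∧
     z₂ = y * (y + 8) / (y + 4)) ∧
    -- level 6, first family
    (let y := etaQuotient [(1, 6), (3, 6), (2, -6), (6, -6)] τ
     let z₁ := etaQuotient [(1, 12), (3, -12)] τ
     let z₂ := etaQuotient [(2, 12), (6, -12)] τ
     z₁ + 729 * z₁⁻¹ + 54 = (y + 16) ^ 3 * (y ^ 2)⁻¹ ∧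
     z₂ + 729 * z₂⁻¹ + 54 = (y + 4) ^ 3 * y⁻¹) ∧
    -- level 6, second family
    (let y := etaQuotient [(1, 2), (2, 2), (3, -2), (6, -2)] τ
     let z₁ := etaQuotient [(1, 12), (2, -12)] τ
     let z₂ := etaQuotient [(3, 12), (6, -12)] τ
     z₁ + 64 * z₁⁻¹ = (y ^ 2 + 27) ^ 2 * (y ^ 3)⁻¹ ∧
     z₂ + 64 * z₂⁻¹ = (y ^ 2 + 3) ^ 2 * y⁻¹) ∧
    -- level 10
    (let y := etaQuotient [(1, 4), (5, 4), (2, -4), (10, -4)] τ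
     let z₁ := etaQuotient [(1, 6), (5, -6)] τ
     let z₂ := etaQuotient [(2, 6), (10, -6)] τ
     z₁ + 125 * z₁⁻¹ + 22 = (y + 4) * (1 + 8 * y⁻¹) ^ 2 ∧
     z₂ + 125 * z₂⁻¹ + 22 = (y + 2) ^ 2 * (1 + 4 * y⁻¹)) ∧
    -- level 12
    (let y := etaQuotient [(1, 2), (3, 2), (4, -2), (12, -2)] τ
     let z₁ := etaQuotient [(1, 12), (3, -12)] τ
     let z₂ := etaQuotient [(2, 6), (6, -6)] τ
     let z₄ := etaQuotient [(4, 12), (12, -12)] τ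
     y + 4 ≠ 0 ∧
     z₁ + 729 * z₁⁻¹ + 54 = (y + 8) ^ 6 / (y ^ 4 * (y + 4)) ∧
     z₂ - 27 * z₂⁻¹ = (y + 2) * (y - 4) * (y + 8) / (y * (y + 4)) ∧
     z₄ + 729 * z₄⁻¹ + 54 = (y + 2) ^ 6 / (y * (y + 4))) ∧
    -- level 14
    (let y := etaQuotient [(1, 3), (7, 3), (2, -3), (14, -3)] τ
     let z₁ := etaQuotient [(1, 4), (7, -4)] τ
     let z₂ := etaQuotient [(2, 4), (14, -4)] τ
     z₁ + 49 * z₁⁻¹ + 13 = (y + 4) ^ 3 * (y ^ 2)⁻¹ ∧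
     z₂ + 49 * z₂⁻¹ + 13 = (y + 2) ^ 3 * y⁻¹) ∧
    -- level 15
    (let y := etaQuotient [(1, 2), (5, 2), (3, -2), (15, -2)] τ
     let z₁ := etaQuotient [(1, 6), (5, -6)] τ
     let z₂ := etaQuotient [(3, 6), (15, -6)] τ
     z₁ + 125 * z₁⁻¹ + 22 = (y + 9 + 27 * y⁻¹) ^ 2 * y⁻¹ ∧
     z₂ + 125 * z₂⁻¹ + 22 = (y + 3 + 3 * y⁻¹) ^ 2 * y) :=
  ⟨relation_level_four rfl rfl,
    relation_level_nine rfl rfl,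
    ⟨level_eight_add_four_ne_zero τ, level_eight_add_eight_ne_zero τ,
      relation_level_eight rfl rfl rfl⟩,
    ⟨relation_level_six_one_three rfl rfl, relation_level_six_two_six rfl rfl⟩,
    ⟨relation_level_six_one_two rfl rfl, relation_level_six_three_six rfl rfl⟩,
    ⟨relation_level_ten_one_five rfl rfl, relation_level_ten_two_ten rfl rfl⟩,
    ⟨level_twelve_add_four_ne_zero τ, relation_level_twelve_one_three rfl rfl,
      relation_level_twelve_two_six rfl rfl, relation_level_twelve_four_twelve rfl rfl⟩,
    ⟨relation_level_fourteen_one_seven rfl rfl, relation_level_fourteen_two_fourteen rfl rfl⟩,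
    ⟨relation_level_fifteen_one_five rfl rfl, relation_level_fifteen_three_fifteen rfl rfl⟩⟩
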